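/- **Setting.** Let $d\ge 1$, $n\ge 2$, and let $\mu$ be the uniform measure on $\{0,1\}^d$. Write $\Delta_i f(x)=f(x^{i\to1})-f(x^{i\to0})$, where $x^{i\to b}$ is $x$ with its $i$-th coordinate replaced by $b$, and, for $X\sim\mu$, $$I(f)=\sum_{i=1}^d\mathbb E|\Delta_i f(X)|,\qquad I^{(2)}(f)=\sum_{i=1}^d\mathbb E\big[(\Delta_i f(X))^2\big],\qquad \|g\|_2^2=\mathbb E[g(X)^2].$$ For $K>0$ let $\mathcal F_K$ be the set of coordinatewise nondecreasing functions $f:\{0,1\}^d\to[0,1]$ with $I(f)\le K$. For $S\subseteq[d]$ let $\chi_S(x)=\prod_{i\in S}(2x_i-1)$. One observes $(X_j,Y_j)$ with $Y_j=f(X_j)+\xi_j$, $j=1,\dots,n$, where $X_1,\dots,X_n$ are i.i.d. with law $\mu$, the noise variables $\xi_1,\dots,\xi_n$ are independent, centered, satisfy $\mathbb E[e^{t\xi_j}]\le e^{\sigma^2t^2/2}$ for all $t\in\mathbb R$, and are independent of $(X_1,\dots,X_n)$. The risk of an estimator $\hat f$ is $R(\hat f,f)=\mathbb E\big[\|\hat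 f-f\|_2^2\big]$, the expectation being over the sample. **Fourier thresholding estimator** with tuning constants $\gamma>2\log3$, $c_0>0$. Put $n_1=\lfloor n/2\rfloor$, $n_2=n-n_1$, $$d_0=\max\Big(\Big\lceil\sqrt{(\log n-c_0\sqrt{\log n})_+/\gamma}\,\Big\rceil,1\Big),\qquad \delta=e^{-\gamma d_0}.$$ For $i\in[d]$, $b\in\{0,1\}$ let $\bar Y_{i,b}$ be the average of the $Y_j$ over those $j\le n_1$ with $X_{j,i}=b$ (and $0$ if there are none), let $\hat I_i=\bar Y_{i,1}-\bar Y_{i,0}$ and $\hat J=\{i:\hat I_i\ge\delta/2\}$. For $S\subseteq[d]$ let $\tilde f(S)=\frac1{n_2}\sum_{j=n_1+1}^nY_j\chi_S(X_j)$. The estimator is $$\hat f_n(x)=\max\Big(0,\min\Big(\sum_{S\subseteq\hat J,\ |S|\le d_0}\tilde f(S)\chi_S(x),\,1\Big)\Big).$$ **Theorem 3 (Upper bound, detailed version).** For every $\gamma>2\log 3$ there is a constant $c_0>0$, depending only on $\gamma$, such that the estimator $\hat f_n$ with these tuning constants satisfies the following. For every $\sigma\ge0$ and $\varepsilon\in(0,1)$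 there exist constants $c,C,C'>0$ (depending only on $\sigma$, $\varepsilon$ and $\gamma$) such that for all integers $n\ge2$, $d\ge1$ with $\log d\le n^{1-\varepsilon}$, every $0<K\le d$, every noise distribution as above and every $f\in\mathcal F_K$: (i) (Uniform bound) $\displaystyle R(\hat f_n,f)\le C\,\frac{K}{\sqrt{\log n}}+C'e^{-c\sqrt{\log n}}$. (ii) (Refined bound) If in addition $K\le\sqrt{\log n}$, then $\displaystyle R(\hat f_n,f)\le C\,\frac{I^{(2)}(f)}{\sqrt{\log n}}+C'e^{-c\sqrt{\log n}}$. -/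

import Mathlib

open MeasureTheory ProbabilityTheory
open scoped NNReal

noncomputable section

namespace HypercubeRegression

/-- The Boolean hypercube `{0,1}^d` (`false` is `0`, `true` is `1`), with the coordinatewise order. -/
abbrev Cube (d : ℕ) : Type := Fin d → Bool

/-- `𝔼_μ[g(X)]` for `X` uniform on the hypercube. -/
def cubeMean {d : ℕ} (g : Cube d → ℝ) : ℝ := (∑ x, g x) / 2 ^ d

/-- The squared norm `‖g‖₂² = 𝔼_μ[g(X)²]`. -/
def sqNorm {d : ℕ} (g : Cube d → ℝ) : ℝ := cubeMean fun x => g x ^ 2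

/-- The discrete derivative `Δ_i f(x) = f(x^{i→1}) - f(x^{i→0})`. -/
def discreteDeriv {d : ℕ} (i : Fin d) (f : Cube d → ℝ) (x : Cube d) : ℝ :=
  f (Function.update x i true) - f (Function.update x i false)

/-- The `L¹`-influence `I_i(f) = 𝔼|Δ_i f(X)|` of coordinate `i`. -/
def influenceOne {d : ℕ} (f : Cube d → ℝ) (i : Fin d) : ℝ :=
  cubeMean fun x => |discreteDeriv i f x|

/-- The total `L¹`-influence `I(f)`. -/
def totalInfluenceOne {d : ℕ} (f : Cube d → ℝ) : ℝ := ∑ i, influenceOne f i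

/-- The `L²`-influence `I_i^{(2)}(f) = 𝔼[(Δ_i f(X))²]` of coordinate `i`. -/
def influenceTwo {d : ℕ} (f : Cube d → ℝ) (i : Fin d) : ℝ :=
  cubeMean fun x => discreteDeriv i f x ^ 2

/-- The total `L²`-influence `I^{(2)}(f)`. -/
def totalInfluenceTwo {d : ℕ} (f : Cube d → ℝ) : ℝ := ∑ i, influenceTwo f i

/-- The class `𝓕_K` of monotone functions `{0,1}^d → [0,1]` with total `L¹`-influence at most `K`. -/
def monotoneClass (d : ℕ) (K : ℝ) : Set (Cube d → ℝ) :=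
  {f | (∀ x, f x ∈ Set.Icc (0 : ℝ) 1) ∧ Monotone f ∧ totalInfluenceOne f ≤ K}

/-- The character `χ_S(x) = ∏_{i ∈ S} (2 x_i - 1)`. -/
def character {d : ℕ} (S : Finset (Fin d)) (x : Cube d) : ℝ :=
  ∏ i ∈ S, (2 * (if x i then 1 else 0) - 1)

/-- A sample of size `n`: the pairs `(X_j, Y_j)`, `j = 0, …, n - 1`. -/
abbrev Sample (n d : ℕ) : Type := Fin n → Cube d × ℝ

/-- The degree cut-off `d₀ = max(⌈√((log n - c₀ √(log n))₊ / γ)⌉, 1)`. -/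
def degreeCutoff (γ c₀ : ℝ) (n : ℕ) : ℕ :=
  max ⌈√(max (Real.log n - c₀ * √(Real.log n)) 0 / γ)⌉₊ 1

/-- The influence threshold `δ = e^{-γ d₀}`. -/
def influenceCutoff (γ c₀ : ℝ) (n : ℕ) : ℝ := Real.exp (-γ * degreeCutoff γ c₀ n)

/-- The indices `j` of the first half of the sample, of size `n₁ = ⌊n/2⌋`. -/
def firstHalf (n : ℕ) : Finset (Fin n) := Finset.univ.filter fun j => (j : ℕ) < n / 2

/-- The indices `j` of the second half of the sample, of size `n₂ = n - n₁`. -/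
def secondHalf (n : ℕ) : Finset (Fin n) := Finset.univ.filter fun j => n / 2 ≤ (j : ℕ)

/-- `Ȳ_{i,b}`: the mean, over the first half of the sample, of the `Y_j` with `X_{j,i} = b`.
It is `0` if there is no such `j`. -/
def conditionalAverage {n d : ℕ} (D : Sample n d) (i : Fin d) (b : Bool) : ℝ :=
  (∑ j ∈ firstHalf n, (D j).2 * (if (D j).1 i = b then 1 else 0)) /
    ∑ j ∈ firstHalf n, (if (D j).1 i = b then 1 else 0)

/-- The estimated influence `Î_i = Ȳ_{i,1} - Ȳ_{i,0}`. -/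
def estimatedInfluence {n d : ℕ} (D : Sample n d) (i : Fin d) : ℝ :=
  conditionalAverage D i true - conditionalAverage D i false

/-- The selected coordinates `Ĵ = {i : Î_i ≥ δ/2}`. -/
def selectedCoords {n d : ℕ} (γ c₀ : ℝ) (D : Sample n d) : Finset (Fin d) :=
  Finset.univ.filter fun i => influenceCutoff γ c₀ n / 2 ≤ estimatedInfluence D i

/-- The estimated spectral set `{S ⊆ Ĵ : |S| ≤ d₀}`. -/
def spectralSet {n d : ℕ} (γ c₀ : ℝ) (D : Sample n d) : Finset (Finset (Fin d)) :=
  (selectedCoords γ c₀ D).powerset.filter fun S => S.card ≤ degreeCutoff γ c₀ n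

/-- The empirical Fourier coefficient of `S`, computed from the second half of the sample. -/
def empiricalCoeff {n d : ℕ} (D : Sample n d) (S : Finset (Fin d)) : ℝ :=
  (∑ j ∈ secondHalf n, (D j).2 * character S (D j).1) / ((n - n / 2 : ℕ) : ℝ)

/-- The Fourier thresholding estimator with tuning constants `γ` and `c₀`. -/
def fourierEstimator {n d : ℕ} (γ c₀ : ℝ) (D : Sample n d) (x : Cube d) : ℝ :=
  max 0 (min (∑ S ∈ spectralSet γ c₀ D, empiricalCoeff D S * character S x) 1)

/-- The random design and noise on the probability space `(Ω, P)`: `X_1, …, X_n` are i.i.d. uniform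
on the hypercube; `ξ_1, …, ξ_n` are independent (not necessarily identically distributed), centered,
and satisfy `𝔼[exp(t ξ_j)] ≤ exp(σ² t² / 2)` for all real `t`; and the noise is independent of the
design. -/
structure IsRegressionModel {Ω : Type*} [MeasurableSpace Ω] (P : Measure Ω) {n d : ℕ} (σ : ℝ≥0)
    (X : Fin n → Ω → Cube d) (ξ : Fin n → Ω → ℝ) : Prop where
  measurable_design : ∀ j, Measurable (X j)
  law_design : ∀ j, P.map (X j) = uniformOn (Set.univ : Set (Cube d))
  indep_design : iIndepFun X P
  measurable_noise : ∀ j, Measurable (ξ j)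
  indep_noise : iIndepFun ξ P
  centered_noise : ∀ j, ∫ ω, ξ j ω ∂P = 0
  subgaussian_noise : ∀ j, HasSubgaussianMGF (ξ j) (σ ^ 2) P
  indep_design_noise : IndepFun (fun ω j => X j ω) (fun ω j => ξ j ω) P

/-- The observed sample `(X_j, Y_j)` with `Y_j = f(X_j) + ξ_j`. -/
def sample {Ω : Type*} {n d : ℕ} (X : Fin n → Ω → Cube d) (ξ : Fin n → Ω → ℝ) (f : Cube d → ℝ)
    (ω : Ω) : Sample n d :=
  fun j => (X j ω, f (X j ω) + ξ j ω)

/-- The integrated squared risk `R(f̂, f) = 𝔼[‖f̂ - f‖₂²]` of an estimator `f̂` (a function of the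
sample), where the expectation is over the sample. -/
def risk {Ω : Type*} [MeasurableSpace Ω] (P : Measure Ω) {n d : ℕ} (X : Fin n → Ω → Cube d)
    (ξ : Fin n → Ω → ℝ) (est : Sample n d → Cube d → ℝ) (f : Cube d → ℝ) : ℝ :=
  ∫ ω, sqNorm (fun x => est (sample X ξ f ω) x - f x) ∂P

end HypercubeRegression

end

open HypercubeRegression

noncomputable section

namespace HypercubeRegression

variable {d : ℕ}

/-! ### Uniform means on the cube -/

/-! Write `L = √(log n)`; the degree cutoff is of order `L` and `δ` is exponentially small in it. By
Parseval the loss splits into the errors of the estimated coefficients and the Fourier weight of `f`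
off the spectral set.

Bias. Weight above degree `d₀` is at most `I⁽²⁾(f)/(4 d₀)`, because `I⁽²⁾` weights each squared
coefficient by `4|S|`. A low-degree set that is missed contains a coordinate of influence at most
`δ`; Bonami's inequality bounds the low-degree weight through coordinate `i` by `3^{d₀} √δ I_i(f) /
4` (`sum_fourierCoeff_sq_of_mem_le`), which is summable in `i`. Since `3^{d₀} √δ = exp(-(γ/2 - log
3) d₀)`, this decays exactly because `γ > 2 log 3`.

Variance. Each coefficient costs `O(1/n)`. Only boundedly many coordinates, at most `4K/δ`, have
influence at least `δ/4`, so about `δ^{-d₀} = exp(γ d₀²)` sets matter, up to a factor `exp(O(d₀))`.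
The constant `c₀` lowers `d₀` enough for the total to be `O(e^{-L})` (`variance_term_le`).

Selection. For monotone `f` an influence is a difference of two half-cube means, so sub-Gaussian
concentration and a union bound over `d` coordinates make every estimated influence accurate to
`δ/4`; `log d ≤ n^{1-ε}` keeps the failure probability below `e^{-L}` for large `n`.

All this is used for `K ≤ L`. For `K ≥ L` the uniform bound is trivial, the risk being at most `1`.
-/

lemma cubeMean_add (g h : Cube d → ℝ) :
    cubeMean (fun x => g x + h x) = cubeMean g + cubeMean h := by
  simp [cubeMean, Finset.sum_add_distrib, add_div]

lemma cubeMean_sub (g h : Cube d → ℝ) :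
    cubeMean (fun x => g x - h x) = cubeMean g - cubeMean h := by
  simp [cubeMean, Finset.sum_sub_distrib, sub_div]

lemma cubeMean_const_mul (c : ℝ) (g : Cube d → ℝ) :
    cubeMean (fun x => c * g x) = c * cubeMean g := by
  simp [cubeMean, ← Finset.mul_sum, mul_div_assoc]

lemma cubeMean_neg (g : Cube d → ℝ) : cubeMean (fun x => -g x) = -cubeMean g := by
  simp [cubeMean, neg_div]

lemma cubeMean_sum {ι : Type*} (s : Finset ι) (g : ι → Cube d → ℝ) :
    cubeMean (fun x => ∑ i ∈ s, g i x) = ∑ i ∈ s, cubeMean (g i) := by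
  simp only [cubeMean]
  rw [Finset.sum_comm, Finset.sum_div]

lemma cubeMean_mono {g h : Cube d → ℝ} (H : ∀ x, g x ≤ h x) : cubeMean g ≤ cubeMean h := by
  unfold cubeMean
  gcongr with x
  exact H x

lemma cubeMean_nonneg {g : Cube d → ℝ} (H : ∀ x, 0 ≤ g x) : 0 ≤ cubeMean g :=
  div_nonneg (Finset.sum_nonneg fun x _ => H x) (by positivity)

lemma cubeMean_const (c : ℝ) : cubeMean (fun _ : Cube d => c) = c := by
  simp [cubeMean]

/-- The Cauchy–Schwarz inequality for the uniform mean. -/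
lemma cubeMean_mul_sq_le (g h : Cube d → ℝ) :
    cubeMean (fun x => g x * h x) ^ 2 ≤
      cubeMean (fun x => g x ^ 2) * cubeMean (fun x => h x ^ 2) := by
  unfold cubeMean
  rw [div_pow, div_mul_div_comm, ← sq]
  gcongr
  exact Finset.sum_mul_sq_le_sq_mul_sq _ _ _

lemma sqNorm_nonneg (g : Cube d → ℝ) : 0 ≤ sqNorm g := cubeMean_nonneg fun _ => sq_nonneg _

/-! ### Flipping a coordinate -/

/-- The vertex `x` with its `i`-th coordinate flipped. -/
def flipAt (i : Fin d) (x : Cube d) : Cube d := Function.update x i (!x i)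

lemma flipAt_involutive (i : Fin d) : Function.Involutive (flipAt i) := by
  intro x
  simp [flipAt]

lemma cubeMean_flipAt (i : Fin d) (g : Cube d → ℝ) :
    cubeMean (fun x => g (flipAt i x)) = cubeMean g := by
  unfold cubeMean
  congr 1
  exact Equiv.sum_comp (flipAt_involutive i).toPerm g

lemma character_sq (S : Finset (Fin d)) (x : Cube d) : character S x ^ 2 = 1 := by
  rw [character, ← Finset.prod_pow]
  refine Finset.prod_eq_one fun i _ => ?_
  split_ifs <;> norm_num

lemma abs_character (S : Finset (Fin d)) (x : Cube d) : |character S x| = 1 := by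
  have := character_sq S x
  rw [← abs_one, ← sq_eq_sq_iff_abs_eq_abs, this, one_pow]

lemma character_flipAt_of_notMem {S : Finset (Fin d)} {i : Fin d} (hi : i ∉ S) (x : Cube d) :
    character S (flipAt i x) = character S x := by
  refine Finset.prod_congr rfl fun j hj => ?_
  rw [flipAt, Function.update_of_ne (by rintro rfl; exact hi hj)]

lemma character_insert {S : Finset (Fin d)} {i : Fin d} (hi : i ∉ S) (x : Cube d) :
    character (insert i S) x = character {i} x * character S x := by
  simp [character, Finset.prod_insert hi]

lemma character_singleton_flipAt (i : Fin d) (x : Cube d) :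
    character {i} (flipAt i x) = -character {i} x := by
  cases h : x i <;> simp [character, flipAt, h] <;> norm_num

lemma character_flipAt_of_mem {S : Finset (Fin d)} {i : Fin d} (hi : i ∈ S) (x : Cube d) :
    character S (flipAt i x) = -character S x := by
  rw [← Finset.insert_erase hi, character_insert (Finset.notMem_erase i S),
    character_insert (Finset.notMem_erase i S), character_singleton_flipAt,
    character_flipAt_of_notMem (Finset.notMem_erase i S)]
  ring

/-! ### Fourier expansion -/

/-- The Fourier coefficient of `f` at `S`. -/
def fourierCoeff (f : Cube d → ℝ) (S : Finset (Fin d)) : ℝ :=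
  cubeMean fun x => f x * character S x

/-- Flipping a coordinate that lies in exactly one of two distinct sets preserves the mean but
negates the product. -/
lemma cubeMean_character_mul (S T : Finset (Fin d)) :
    cubeMean (fun x => character S x * character T x) = if S = T then 1 else 0 := by
  split_ifs with h
  · subst h
    simp_rw [← sq, character_sq, cubeMean_const]
  · have : ∃ i, ¬(i ∈ S ↔ i ∈ T) := by
      by_contra! H
      exact h (Finset.ext H)
    obtain ⟨i, hi⟩ := this
    have h2 : cubeMean (fun x => character S x * character T x) =
        -cubeMean (fun x => character S x * character T x) := by
      conv_lhs => rw [← cubeMean_flipAt i]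
      rw [← cubeMean_neg]
      congr 1
      funext x
      by_cases hS : i ∈ S
      · have hT : i ∉ T := fun hT => hi (by simp [hS, hT])
        rw [character_flipAt_of_mem hS, character_flipAt_of_notMem hT]
        ring
      · have hT : i ∈ T := by
          by_contra hT
          exact hi (by simp [hS, hT])
        rw [character_flipAt_of_mem hT, character_flipAt_of_notMem hS]
        ring
    linarith

/-- The sum factorises over coordinates; a factor is `2` where `x` and `y` agree and `0` where they
differ. -/
lemma sum_character_mul_character (x y : Cube d) :
    ∑ S, character S x * character S y = if x = y then 2 ^ d else 0 := by
  have h1 : ∑ S, character S x * character S y =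
      ∏ i : Fin d, (1 + (2 * (if x i then 1 else 0) - 1) * (2 * (if y i then 1 else 0) - 1) : ℝ) := by
    rw [Finset.prod_one_add, Finset.powerset_univ]
    simp [character, Finset.prod_mul_distrib]
  rw [h1]
  split_ifs with h
  · subst h
    rw [Finset.prod_congr rfl (g := fun _ => (2 : ℝ))]
    · simp
    · intro i _
      split_ifs <;> norm_num
  · obtain ⟨i, hi⟩ := Function.ne_iff.mp h
    refine Finset.prod_eq_zero (Finset.mem_univ i) ?_
    cases hx : x i <;> cases hy : y i <;> simp_all <;> norm_num

lemma sum_fourierCoeff_mul_character (f : Cube d → ℝ) (x : Cube d) :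
    ∑ S, fourierCoeff f S * character S x = f x := by
  simp only [fourierCoeff, cubeMean, div_mul_eq_mul_div, Finset.sum_mul]
  rw [← Finset.sum_div, Finset.sum_comm]
  simp_rw [mul_assoc, ← Finset.mul_sum, sum_character_mul_character]
  simp

/-- Parseval's identity. -/
lemma sqNorm_sum_character (A : Finset (Finset (Fin d))) (a : Finset (Fin d) → ℝ) :
    sqNorm (fun x => ∑ S ∈ A, a S * character S x) = ∑ S ∈ A, a S ^ 2 := by
  have h : ∀ x, (∑ S ∈ A, a S * character S x) ^ 2 =
      ∑ S ∈ A, ∑ T ∈ A, (a S * a T) * (character S x * character T x) := by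
    intro x
    rw [sq, Finset.sum_mul_sum]
    refine Finset.sum_congr rfl fun S _ => Finset.sum_congr rfl fun T _ => by ring
  simp_rw [sqNorm, h, cubeMean_sum, cubeMean_const_mul, cubeMean_character_mul]
  refine Finset.sum_congr rfl fun S hS => ?_
  simp [hS, sq]

lemma discreteDeriv_eq (i : Fin d) (f : Cube d → ℝ) (x : Cube d) :
    discreteDeriv i f x = (f x - f (flipAt i x)) * character {i} x := by
  have hx : Function.update x i (x i) = x := Function.update_eq_self i x
  cases h : x i
  · rw [h] at hx
    simp [discreteDeriv, flipAt, character, h, hx]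
  · rw [h] at hx
    simp [discreteDeriv, flipAt, character, h, hx]
    norm_num

lemma sub_flipAt_eq_sum (i : Fin d) (f : Cube d → ℝ) (x : Cube d) :
    f x - f (flipAt i x) =
      ∑ S ∈ Finset.univ.filter (i ∈ ·), 2 * fourierCoeff f S * character S x := by
  rw [← sum_fourierCoeff_mul_character f x, ← sum_fourierCoeff_mul_character f (flipAt i x),
    ← Finset.sum_sub_distrib, Finset.sum_filter]
  refine Finset.sum_congr rfl fun S _ => ?_
  split_ifs with h
  · rw [character_flipAt_of_mem h]; ring
  · rw [character_flipAt_of_notMem h]; ring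

/-- A flip at `i` cancels the terms without `i` and doubles the others; the sign relating this
difference to the derivative disappears on squaring, and Parseval applies. -/
lemma influenceTwo_eq_sum (f : Cube d → ℝ) (i : Fin d) :
    influenceTwo f i = ∑ S ∈ Finset.univ.filter (i ∈ ·), 4 * fourierCoeff f S ^ 2 := by
  have h : ∀ x, discreteDeriv i f x ^ 2 =
      (∑ S ∈ Finset.univ.filter (i ∈ ·), 2 * fourierCoeff f S * character S x) ^ 2 := by
    intro x
    rw [discreteDeriv_eq, mul_pow, character_sq, mul_one, sub_flipAt_eq_sum]
  simp_rw [influenceTwo, h]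
  rw [← sqNorm, sqNorm_sum_character]
  refine Finset.sum_congr rfl fun S _ => by ring

lemma totalInfluenceTwo_eq_sum (f : Cube d → ℝ) :
    totalInfluenceTwo f = ∑ S, 4 * (S.card : ℝ) * fourierCoeff f S ^ 2 := by
  simp_rw [totalInfluenceTwo, influenceTwo_eq_sum, Finset.sum_filter]
  rw [Finset.sum_comm]
  refine Finset.sum_congr rfl fun S _ => ?_
  simp
  ring

lemma totalInfluenceTwo_nonneg (f : Cube d → ℝ) : 0 ≤ totalInfluenceTwo f :=
  Finset.sum_nonneg fun _ _ => cubeMean_nonneg fun _ => sq_nonneg _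

/-- The Fourier weight above degree `D` is controlled by the total influence. -/
lemma sum_fourierCoeff_sq_of_lt_card_le (f : Cube d → ℝ) {D : ℕ} (hD : 0 < D) :
    ∑ S ∈ Finset.univ.filter (fun S : Finset (Fin d) => D < S.card), fourierCoeff f S ^ 2 ≤
      totalInfluenceTwo f / (4 * D) := by
  rw [le_div_iff₀ (by positivity), totalInfluenceTwo_eq_sum, Finset.sum_mul]
  refine le_trans (Finset.sum_le_sum fun S hS => ?_)
    (Finset.sum_le_sum_of_subset_of_nonneg (Finset.filter_subset _ _)
      fun S _ _ => by positivity)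
  have : (D : ℝ) ≤ S.card := by exact_mod_cast (Finset.mem_filter.mp hS).2.le
  nlinarith [sq_nonneg (fourierCoeff f S)]

/-! ### Hypercontractivity -/

/-- The `(2, 4)` hypercontractive inequality of Bonami. -/
theorem cubeMean_pow_four_le (T : Finset (Fin d)) (a : Finset (Fin d) → ℝ) :
    cubeMean (fun x => (∑ S ∈ T.powerset, a S * character S x) ^ 4) ≤
      (∑ S ∈ T.powerset, 3 ^ S.card * a S ^ 2) ^ 2 := by
  induction T using Finset.induction_on generalizing a with
  | empty =>
    simp only [Finset.powerset_empty, Finset.sum_singleton, character, Finset.prod_empty,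
      Finset.card_empty]
    rw [cubeMean_const]
    apply le_of_eq
    ring
  | insert i T hi ih =>
    -- Induction on the number of variables: the polynomial is `q + χ_{i} r` with `q`, `r` free of
    -- coordinate `i`. Averaging over the flip at `i` kills odd powers, leaving `𝔼q⁴ + 6 𝔼q²r² + 𝔼r⁴
    -- ≤ A² + 6AB + B² ≤ (A + 3B)²`.
    set q : Cube d → ℝ := fun x => ∑ S ∈ T.powerset, a S * character S x with hq
    set r : Cube d → ℝ := fun x => ∑ S ∈ T.powerset, a (insert i S) * character S x with hr
    set A := ∑ S ∈ T.powerset, 3 ^ S.card * a S ^ 2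
    set B := ∑ S ∈ T.powerset, 3 ^ S.card * a (insert i S) ^ 2
    have hA0 : 0 ≤ A := Finset.sum_nonneg fun _ _ => by positivity
    have hB0 : 0 ≤ B := Finset.sum_nonneg fun _ _ => by positivity
    have hA : cubeMean (fun x => q x ^ 4) ≤ A ^ 2 := ih a
    have hB : cubeMean (fun x => r x ^ 4) ≤ B ^ 2 := ih fun S => a (insert i S)
    have hAB : cubeMean (fun x => q x ^ 2 * r x ^ 2) ≤ A * B := by
      refine le_of_sq_le_sq ?_ (by positivity)
      refine (cubeMean_mul_sq_le _ _).trans ?_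
      simp only [← pow_mul]
      norm_num
      rw [mul_pow]
      exact mul_le_mul hA hB (cubeMean_nonneg fun x => by positivity) (by positivity)
    have hnot : ∀ S ∈ T.powerset, i ∉ S := fun S hS h => hi (Finset.mem_powerset.mp hS h)
    have hsplit : ∀ x, ∑ S ∈ (insert i T).powerset, a S * character S x =
        q x + character {i} x * r x := by
      intro x
      rw [Finset.sum_powerset_insert hi, hq, hr, Finset.mul_sum]
      congr 1
      refine Finset.sum_congr rfl fun S hS => ?_
      rw [character_insert (hnot S hS)]
      ring
    have hsplit2 : ∑ S ∈ (insert i T).powerset, 3 ^ S.card * a S ^ 2 = A + 3 * B := by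
      rw [Finset.sum_powerset_insert hi, Finset.mul_sum]
      congr 1
      refine Finset.sum_congr rfl fun S hS => ?_
      rw [Finset.card_insert_of_notMem (hnot S hS)]
      ring
    have hqf : ∀ x, q (flipAt i x) = q x := fun x =>
      Finset.sum_congr rfl fun S hS => by rw [character_flipAt_of_notMem (hnot S hS)]
    have hrf : ∀ x, r (flipAt i x) = r x := fun x =>
      Finset.sum_congr rfl fun S hS => by rw [character_flipAt_of_notMem (hnot S hS)]
    have hmean : cubeMean (fun x => (q x + character {i} x * r x) ^ 4) =
        cubeMean (fun x => q x ^ 4) + 6 * cubeMean (fun x => q x ^ 2 * r x ^ 2) +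
          cubeMean (fun x => r x ^ 4) := by
      have h1 := cubeMean_flipAt i (fun x => (q x + character {i} x * r x) ^ 4)
      simp only [hqf, hrf, character_singleton_flipAt] at h1
      have h2 : cubeMean (fun x => (q x + -character {i} x * r x) ^ 4 +
          (q x + character {i} x * r x) ^ 4) = cubeMean (fun x => 2 * (q x ^ 4 +
            6 * (q x ^ 2 * r x ^ 2) + r x ^ 4)) := by
        congr 1
        funext x
        have h3 := character_sq {i} x
        linear_combination (12 * q x ^ 2 * r x ^ 2 +
          2 * r x ^ 4 * (character {i} x ^ 2 + 1)) * h3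
      rw [cubeMean_add, h1, cubeMean_const_mul, cubeMean_add, cubeMean_add,
        cubeMean_const_mul] at h2
      linarith
    simp_rw [hsplit]
    rw [hsplit2, hmean]
    nlinarith

/-- An interpolation form of Hölder's inequality for a weight `g` with values in `[0, 1]`. -/
lemma cubeMean_mul_abs_sq_le {g h : Cube d → ℝ} (hg0 : ∀ x, 0 ≤ g x) (hg1 : ∀ x, g x ≤ 1) {B : ℝ}
    (hB : 0 ≤ B) (hfour : cubeMean (fun x => h x ^ 4) ≤ B ^ 2) :
    cubeMean (fun x => g x * |h x|) ^ 2 ≤ cubeMean g * (√(cubeMean g) * B) := by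
  have hI0 : 0 ≤ cubeMean g := cubeMean_nonneg hg0
  -- Cauchy–Schwarz twice, each time splitting off `√g`: from the first absolute moment of `h` under
  -- the weight `g` to the second, then to the fourth.
  have hcs1 : cubeMean (fun x => g x * |h x|) ^ 2 ≤
      cubeMean g * cubeMean (fun x => g x * h x ^ 2) := by
    have := cubeMean_mul_sq_le (fun x => √(g x)) (fun x => √(g x) * |h x|)
    simp only [mul_pow, Real.sq_sqrt (hg0 _), ← mul_assoc, Real.mul_self_sqrt (hg0 _), sq_abs]
      at this
    exact this
  have hcs2 : cubeMean (fun x => g x * h x ^ 2) ^ 2 ≤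
      cubeMean g * cubeMean (fun x => g x * h x ^ 4) := by
    have := cubeMean_mul_sq_le (fun x => √(g x)) (fun x => √(g x) * h x ^ 2)
    simp only [mul_pow, Real.sq_sqrt (hg0 _), ← mul_assoc, Real.mul_self_sqrt (hg0 _), ← pow_mul]
      at this
    exact this
  have hgh : cubeMean (fun x => g x * h x ^ 4) ≤ B ^ 2 := by
    refine (cubeMean_mono fun x => ?_).trans hfour
    exact mul_le_of_le_one_left (by positivity) (hg1 x)
  refine hcs1.trans (mul_le_mul_of_nonneg_left ?_ hI0)
  refine le_of_sq_le_sq (hcs2.trans ?_) (by positivity)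
  rw [mul_pow, Real.sq_sqrt hI0]
  exact mul_le_mul_of_nonneg_left hgh hI0

lemma abs_discreteDeriv_le_one {f : Cube d → ℝ} (hf : ∀ x, f x ∈ Set.Icc (0 : ℝ) 1) (i : Fin d)
    (x : Cube d) : |discreteDeriv i f x| ≤ 1 := by
  have h1 := hf (Function.update x i true)
  have h2 := hf (Function.update x i false)
  rw [Set.mem_Icc] at h1 h2
  exact abs_le.mpr ⟨by simp only [discreteDeriv]; linarith, by simp only [discreteDeriv]; linarith⟩

lemma influenceTwo_le_influenceOne {f : Cube d → ℝ} (hf : ∀ x, f x ∈ Set.Icc (0 : ℝ) 1)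
    (i : Fin d) : influenceTwo f i ≤ influenceOne f i := by
  refine cubeMean_mono fun x => ?_
  rw [← sq_abs, sq]
  exact mul_le_of_le_one_left (abs_nonneg _) (abs_discreteDeriv_le_one hf i x)

lemma totalInfluenceTwo_le_totalInfluenceOne {f : Cube d → ℝ}
    (hf : ∀ x, f x ∈ Set.Icc (0 : ℝ) 1) : totalInfluenceTwo f ≤ totalInfluenceOne f :=
  Finset.sum_le_sum fun i _ => influenceTwo_le_influenceOne hf i

/-- The low-degree Fourier weight of a derivative, bounded through hypercontractivity. -/
lemma sum_fourierCoeff_sq_of_mem_le {f : Cube d → ℝ} (hf : ∀ x, f x ∈ Set.Icc (0 : ℝ) 1)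
    (i : Fin d) (D : ℕ) {δ : ℝ} (hδ : influenceOne f i ≤ δ) :
    ∑ S ∈ Finset.univ.filter (fun S : Finset (Fin d) => i ∈ S ∧ S.card ≤ D),
      fourierCoeff f S ^ 2 ≤ 3 ^ D * √δ * influenceOne f i / 4 := by
  set A := Finset.univ.filter (fun S : Finset (Fin d) => i ∈ S ∧ S.card ≤ D) with hA
  set h : Cube d → ℝ := fun x => ∑ S ∈ A, fourierCoeff f S * character S x with hh
  set W := ∑ S ∈ A, fourierCoeff f S ^ 2 with hW
  set g : Cube d → ℝ := fun x => |discreteDeriv i f x| with hg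
  set I := influenceOne f i with hI
  have hW0 : 0 ≤ W := Finset.sum_nonneg fun _ _ => sq_nonneg _
  have hI0 : 0 ≤ I := cubeMean_nonneg fun _ => abs_nonneg _
  have hg0 : ∀ x, 0 ≤ g x := fun x => abs_nonneg _
  have hg1 : ∀ x, g x ≤ 1 := abs_discreteDeriv_le_one hf i
  have hfour : cubeMean (fun x => h x ^ 4) ≤ (3 ^ D * W) ^ 2 := by
    have h1 := cubeMean_pow_four_le Finset.univ (fun S => if S ∈ A then fourierCoeff f S else 0)
    simp only [Finset.powerset_univ, ite_mul, zero_mul, ite_pow, mul_ite, mul_zero,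
      zero_pow two_ne_zero, Finset.sum_ite_mem, Finset.univ_inter] at h1
    refine h1.trans ?_
    rw [hW, Finset.mul_sum]
    gcongr with S hS
    · norm_num
    · exact (Finset.mem_filter.mp hS).2.2
  have hodd : ∀ x, h (flipAt i x) = -h x := by
    intro x
    rw [hh]
    simp only [← Finset.sum_neg_distrib]
    refine Finset.sum_congr rfl fun S hS => ?_
    rw [character_flipAt_of_mem (Finset.mem_filter.mp hS).2.1]
    ring
  have hWf : W = cubeMean (fun x => f x * h x) := by
    simp_rw [hh, Finset.mul_sum, cubeMean_sum]
    refine Finset.sum_congr rfl fun S _ => ?_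
    rw [sq, fourierCoeff, ← cubeMean_const_mul]
    congr 1
    funext x
    ring
  -- Since `h` is odd under the flip at `i`, pairing it with `f` only sees the antisymmetric part of
  -- `f`, which is the derivative up to sign.
  have hWg : 2 * W ≤ cubeMean (fun x => g x * |h x|) := by
    have h1 := cubeMean_flipAt i (fun x => f x * h x)
    simp only [hodd] at h1
    have h2 : 2 * W = cubeMean (fun x => (f x - f (flipAt i x)) * h x) := by
      have : (fun x => (f x - f (flipAt i x)) * h x) =
          fun x => f x * h x + f (flipAt i x) * -h x := by funext x; ring
      rw [this, cubeMean_add, h1, ← hWf]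
      ring
    rw [h2]
    refine cubeMean_mono fun x => ?_
    have h3 : g x = |f x - f (flipAt i x)| := by
      rw [hg]
      simp only [discreteDeriv_eq, abs_mul, abs_character, mul_one]
    rw [h3, ← abs_mul]
    exact le_abs_self _
  -- `W` enters squared on the left and linearly on the right, so dividing by it gives the bound; `W
  -- = 0` is treated apart.
  have hlast : (2 * W) ^ 2 ≤ I * (√I * (3 ^ D * W)) :=
    (pow_le_pow_left₀ (by positivity) hWg 2).trans
      (cubeMean_mul_abs_sq_le hg0 hg1 (by positivity) hfour)
  have hδI : √I ≤ √δ := Real.sqrt_le_sqrt hδ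
  clear_value W I
  rcases hW0.eq_or_lt with h0 | h0
  · exact h0.symm.trans_le (by positivity)
  · have h5 : 4 * W ≤ I * (√I * 3 ^ D) := by
      refine le_of_mul_le_mul_right ?_ h0
      linarith
    have h6 : I * (√I * 3 ^ D) ≤ I * (√δ * 3 ^ D) := by gcongr
    linarith

/-! ### Loss of the estimator for a fixed sample -/

lemma sq_clip_sub_le {y z : ℝ} (hz : z ∈ Set.Icc (0 : ℝ) 1) :
    (max 0 (min y 1) - z) ^ 2 ≤ (y - z) ^ 2 := by
  obtain ⟨h0, h1⟩ := hz
  rcases le_total y 1 with h | h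
  · rw [min_eq_left h]
    rcases le_total 0 y with h' | h'
    · rw [max_eq_right h']
    · rw [max_eq_left h']
      nlinarith
  · rw [min_eq_right h, max_eq_right zero_le_one]
    nlinarith

lemma sqNorm_mono {g h : Cube d → ℝ} (H : ∀ x, g x ^ 2 ≤ h x ^ 2) : sqNorm g ≤ sqNorm h :=
  cubeMean_mono H

lemma sqNorm_fourierEstimator_sub_le_one {n : ℕ} (γ c₀ : ℝ) (D : Sample n d) {f : Cube d → ℝ}
    (hf : ∀ x, f x ∈ Set.Icc (0 : ℝ) 1) :
    sqNorm (fun x => fourierEstimator γ c₀ D x - f x) ≤ 1 := by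
  rw [← cubeMean_const (d := d) 1]
  refine cubeMean_mono fun x => ?_
  obtain ⟨h0, h1⟩ := hf x
  have h2 : 0 ≤ fourierEstimator γ c₀ D x := le_max_left _ _
  have h3 : fourierEstimator γ c₀ D x ≤ 1 := max_le zero_le_one (min_le_right _ _)
  nlinarith

lemma sqNorm_fourierEstimator_sub_le {n : ℕ} (γ c₀ : ℝ) (D : Sample n d) {f : Cube d → ℝ}
    (hf : ∀ x, f x ∈ Set.Icc (0 : ℝ) 1) :
    sqNorm (fun x => fourierEstimator γ c₀ D x - f x) ≤
      ∑ S ∈ spectralSet γ c₀ D, (empiricalCoeff D S - fourierCoeff f S) ^ 2 +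
        ∑ S ∈ (spectralSet γ c₀ D)ᶜ, fourierCoeff f S ^ 2 := by
  set A := spectralSet γ c₀ D with hA
  have h1 : sqNorm (fun x => fourierEstimator γ c₀ D x - f x) ≤
      sqNorm (fun x => ∑ S, ((if S ∈ A then empiricalCoeff D S else 0) - fourierCoeff f S) *
        character S x) := by
    refine sqNorm_mono fun x => ?_
    refine (sq_clip_sub_le (hf x)).trans_eq ?_
    simp only [sub_mul, Finset.sum_sub_distrib, sum_fourierCoeff_mul_character, ite_mul, zero_mul,
      Finset.sum_ite_mem, Finset.univ_inter]
    rfl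
  rw [sqNorm_sum_character, ← Finset.sum_add_sum_compl A] at h1
  refine h1.trans_eq ?_
  congr 1
  · exact Finset.sum_congr rfl fun S hS => by rw [if_pos hS]
  · refine Finset.sum_congr rfl fun S hS => ?_
    rw [if_neg (Finset.mem_compl.mp hS)]
    ring

/-- The sets of at most `D` coordinates, all of influence at least `θ`. -/
def influentialSets (f : Cube d → ℝ) (θ : ℝ) (D : ℕ) : Finset (Finset (Fin d)) :=
  (Finset.univ.filter fun i => θ ≤ influenceOne f i).powerset.filter fun S => S.card ≤ D

lemma influenceOne_nonneg (f : Cube d → ℝ) (i : Fin d) : 0 ≤ influenceOne f i :=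
  cubeMean_nonneg fun _ => abs_nonneg _

lemma influenceCutoff_pos (γ c₀ : ℝ) (n : ℕ) : 0 < influenceCutoff γ c₀ n := Real.exp_pos _

lemma degreeCutoff_pos (γ c₀ : ℝ) (n : ℕ) : 0 < degreeCutoff γ c₀ n :=
  lt_of_lt_of_le Nat.zero_lt_one (le_max_right _ _)

/-- The Fourier weight of the low-degree sets that involve a coordinate of small influence. -/
lemma sum_fourierCoeff_sq_of_not_subset_le {f : Cube d → ℝ} (hf : ∀ x, f x ∈ Set.Icc (0 : ℝ) 1)
    {J : Finset (Fin d)} (D : ℕ) {δ : ℝ} (hJ : ∀ i, i ∉ J → influenceOne f i ≤ δ) :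
    ∑ S ∈ Finset.univ.filter (fun S : Finset (Fin d) => ¬ S ⊆ J ∧ S.card ≤ D),
      fourierCoeff f S ^ 2 ≤ 3 ^ D * √δ * totalInfluenceOne f / 4 := by
  -- Each set not inside `J` is charged to one of its coordinates outside `J`, reducing to the bound
  -- for a single coordinate.
  calc _ ≤ ∑ S ∈ Finset.univ.filter (fun S : Finset (Fin d) => ¬ S ⊆ J ∧ S.card ≤ D),
        ∑ i ∈ Jᶜ, if i ∈ S ∧ S.card ≤ D then fourierCoeff f S ^ 2 else 0 := by
        refine Finset.sum_le_sum fun S hS => ?_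
        obtain ⟨hSJ, hSD⟩ := (Finset.mem_filter.mp hS).2
        obtain ⟨i, hiS, hiJ⟩ := Finset.not_subset.mp hSJ
        refine le_trans (le_of_eq ?_) (Finset.single_le_sum (fun j _ => ?_)
          (Finset.mem_compl.mpr hiJ))
        · rw [if_pos ⟨hiS, hSD⟩]
        · split_ifs <;> positivity
    _ ≤ ∑ S, ∑ i ∈ Jᶜ, if i ∈ S ∧ S.card ≤ D then fourierCoeff f S ^ 2 else 0 := by
        refine Finset.sum_le_sum_of_subset_of_nonneg (Finset.filter_subset _ _) fun S _ _ => ?_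
        exact Finset.sum_nonneg fun i _ => by split_ifs <;> positivity
    _ = ∑ i ∈ Jᶜ, ∑ S ∈ Finset.univ.filter (fun S : Finset (Fin d) => i ∈ S ∧ S.card ≤ D),
          fourierCoeff f S ^ 2 := by
        rw [Finset.sum_comm]
        simp_rw [Finset.sum_filter]
    _ ≤ ∑ i ∈ Jᶜ, 3 ^ D * √δ * influenceOne f i / 4 :=
        Finset.sum_le_sum fun i hi =>
          sum_fourierCoeff_sq_of_mem_le hf i D (hJ i (Finset.mem_compl.mp hi))
    _ ≤ ∑ i, 3 ^ D * √δ * influenceOne f i / 4 := by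
        refine Finset.sum_le_sum_of_subset_of_nonneg (Finset.subset_univ _) fun i _ _ => ?_
        have := influenceOne_nonneg f i
        positivity
    _ = _ := by rw [totalInfluenceOne, Finset.mul_sum, Finset.sum_div]

/-- With threshold `δ/2` and accuracy `δ/4`, selected coordinates have influence at least `δ/4` and
rejected ones less than `δ`. Hence the random spectral set lies in a deterministic family, over
which the errors can be summed before taking expectations. -/
lemma sqNorm_fourierEstimator_sub_le_of_abs_sub_le {n : ℕ} (γ c₀ : ℝ) (D : Sample n d)
    {f : Cube d → ℝ} (hf : ∀ x, f x ∈ Set.Icc (0 : ℝ) 1)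
    (hD : ∀ i, |estimatedInfluence D i - influenceOne f i| ≤ influenceCutoff γ c₀ n / 4) :
    sqNorm (fun x => fourierEstimator γ c₀ D x - f x) ≤
      ∑ S ∈ influentialSets f (influenceCutoff γ c₀ n / 4) (degreeCutoff γ c₀ n),
          (empiricalCoeff D S - fourierCoeff f S) ^ 2 +
        (totalInfluenceTwo f / (4 * degreeCutoff γ c₀ n) +
          3 ^ degreeCutoff γ c₀ n * √(influenceCutoff γ c₀ n) * totalInfluenceOne f / 4) := by
  have hδ := influenceCutoff_pos γ c₀ n
  set δ := influenceCutoff γ c₀ n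
  set D₀ := degreeCutoff γ c₀ n with hD₀
  refine (sqNorm_fourierEstimator_sub_le γ c₀ D hf).trans (add_le_add ?_ ?_)
  · refine Finset.sum_le_sum_of_subset_of_nonneg (fun S hS => ?_) fun _ _ _ => sq_nonneg _
    simp only [spectralSet, influentialSets, Finset.mem_filter, Finset.mem_powerset] at hS ⊢
    refine ⟨fun i hi => ?_, hS.2⟩
    have h1 := hS.1 hi
    simp only [selectedCoords, Finset.mem_filter, Finset.mem_univ, true_and] at h1 ⊢
    linarith [(abs_le.mp (hD i)).2]
  · have hJ : ∀ i, i ∉ selectedCoords γ c₀ D → influenceOne f i ≤ δ := by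
      intro i hi
      simp only [selectedCoords, Finset.mem_filter, Finset.mem_univ, true_and, not_le] at hi
      linarith [(abs_le.mp (hD i)).1]
    refine le_trans ?_ (add_le_add (sum_fourierCoeff_sq_of_lt_card_le f (degreeCutoff_pos γ c₀ n))
      (sum_fourierCoeff_sq_of_not_subset_le hf D₀ hJ))
    rw [Finset.sum_filter, Finset.sum_filter, ← Finset.sum_add_distrib]
    refine le_trans (Finset.sum_le_sum fun S hS => ?_)
      (Finset.sum_le_sum_of_subset_of_nonneg (Finset.subset_univ (spectralSet γ c₀ D)ᶜ)
        fun S _ _ => by split_ifs <;> positivity)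
    simp only [spectralSet, Finset.mem_compl, Finset.mem_filter, Finset.mem_powerset,
      not_and, ← hD₀] at hS
    by_cases h : D₀ < S.card
    · rw [if_pos h]
      exact le_add_of_nonneg_right (by split_ifs <;> positivity)
    · rw [if_neg h, if_pos ⟨fun h' => hS h' (not_lt.mp h), not_lt.mp h⟩, zero_add]

/-! ### Counting the influential sets -/

/-- Each counted set gets the weight `(M/D)^(D - |t|) ≥ 1`; summed over all subsets of `s` the
weights factorise, and `(1 + D/M)^|s| ≤ e^D`. -/
lemma card_powerset_filter_card_le {α : Type*} [DecidableEq α] (s : Finset α) {D : ℕ}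
    (hD : 0 < D) {M : ℝ} (hDM : D ≤ M) (hsM : s.card ≤ M) :
    ((s.powerset.filter fun t => t.card ≤ D).card : ℝ) ≤ (M / D * Real.exp 1) ^ D := by
  have hD' : (0 : ℝ) < D := by exact_mod_cast hD
  have hM : 0 < M := hD'.trans_le hDM
  have h1 : 1 ≤ M / D := (one_le_div hD').mpr hDM
  calc ((s.powerset.filter fun t => t.card ≤ D).card : ℝ)
      = ∑ t ∈ s.powerset.filter fun t => t.card ≤ D, (1 : ℝ) := by simp
    _ ≤ ∑ t ∈ s.powerset.filter fun t => t.card ≤ D, (M / D) ^ D * (D / M) ^ t.card := by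
        refine Finset.sum_le_sum fun t ht => ?_
        have h2 : (M / D) ^ t.card * (D / M) ^ t.card = 1 := by
          rw [← mul_pow, div_mul_div_comm, mul_comm M, div_self (by positivity), one_pow]
        rw [← h2]
        gcongr
        exact (Finset.mem_filter.mp ht).2
    _ ≤ ∑ t ∈ s.powerset, (M / D) ^ D * (D / M) ^ t.card :=
        Finset.sum_le_sum_of_subset_of_nonneg (Finset.filter_subset _ _) fun _ _ _ => by positivity
    _ = (M / D) ^ D * (D / M + 1) ^ s.card := by
        rw [← Finset.mul_sum, ← Finset.sum_pow_mul_eq_add_pow]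
        simp
    _ ≤ (M / D) ^ D * Real.exp D := by
        gcongr
        calc (D / M + 1) ^ s.card ≤ Real.exp (D / M) ^ s.card := by
              gcongr
              exact Real.add_one_le_exp _
          _ = Real.exp (D * (s.card / M)) := by
              rw [← Real.exp_nat_mul]
              congr 1
              ring
          _ ≤ Real.exp D := by
              gcongr
              exact mul_le_of_le_one_right hD'.le ((div_le_one hM).mpr hsM)
    _ = (M / D * Real.exp 1) ^ D := by
        rw [mul_pow, ← Real.exp_nat_mul, mul_one]

/-- At most `4K/δ` coordinates have influence at least `δ/4`. The count is applied with `M = (4K +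
D)/δ`, the extra `D/δ` ensuring `D ≤ M`. -/
lemma card_influentialSets_le {f : Cube d → ℝ} {K δ : ℝ} (hK : 0 < K)
    (hf : totalInfluenceOne f ≤ K) (hδ : 0 < δ) (hδ1 : δ ≤ 1) {D : ℕ} (hD : 0 < D) :
    ((influentialSets f (δ / 4) D).card : ℝ) ≤ ((4 * K / D + 1) / δ * Real.exp 1) ^ D := by
  have hD' : (0 : ℝ) < D := by exact_mod_cast hD
  have hM : (4 * K / D + 1) / δ = (4 * K + D) / δ / D := by field_simp
  rw [hM]
  refine card_powerset_filter_card_le _ hD ?_ ?_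
  · rw [le_div_iff₀ hδ]
    nlinarith
  · have h1 : (Finset.univ.filter fun i => δ / 4 ≤ influenceOne f i).card * (δ / 4) ≤ K := by
      refine le_trans ?_ hf
      rw [← nsmul_eq_mul]
      refine (Finset.card_nsmul_le_sum _ (influenceOne f) _ fun i hi =>
        (Finset.mem_filter.mp hi).2).trans ?_
      exact Finset.sum_le_sum_of_subset_of_nonneg (Finset.subset_univ _)
        fun i _ _ => influenceOne_nonneg f i
    rw [le_div_iff₀ hδ]
    linarith

/-! ### Independence of the observations -/

/-- Two independent families, each consisting of independent variables, form a family of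
independent pairs. -/
lemma iIndepFun_prodMk {Ω ι α β : Type*} [Fintype ι] [MeasurableSpace Ω] [MeasurableSpace α]
    [MeasurableSpace β] {P : Measure Ω} {X : ι → Ω → α} {Y : ι → Ω → β}
    (hX : iIndepFun X P) (hY : iIndepFun Y P) (mX : ∀ i, Measurable (X i))
    (mY : ∀ i, Measurable (Y i)) (hXY : IndepFun (fun ω i => X i ω) (fun ω i => Y i ω) P) :
    iIndepFun (fun i ω => (X i ω, Y i ω)) P := by
  rw [iIndepFun_iff_iIndep]
  -- Independence need only be checked on measurable rectangles, a π-system generating each pair's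
  -- σ-algebra.
  refine iIndepSets.iIndep (fun i => ((mX i).prodMk (mY i)).comap_le)
    (fun i => Set.preimage (fun ω => (X i ω, Y i ω)) ''
      Set.image2 (· ×ˢ ·) {s : Set α | MeasurableSet s} {t : Set β | MeasurableSet t})
    (fun i => isPiSystem_prod.comap _) (fun i => ?_) ?_
  · rw [← MeasurableSpace.comap_generateFrom, generateFrom_prod]
  · rw [iIndepSets_iff]
    intro S f hf
    have hf' : ∀ i, ∃ A B, MeasurableSet A ∧ MeasurableSet B ∧
        (i ∈ S → f i = X i ⁻¹' A ∩ Y i ⁻¹' B) := by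
      intro i
      by_cases hi : i ∈ S
      · obtain ⟨_, ⟨A, hA, B, hB, rfl⟩, h⟩ := hf i hi
        exact ⟨A, B, hA, hB, fun _ => by rw [← h]; rfl⟩
      · exact ⟨∅, ∅, .empty, .empty, fun h => absurd h hi⟩
    choose A B hA hB hAB using hf'
    have h1 : ⋂ i ∈ S, f i = (fun ω i => X i ω) ⁻¹' (⋂ i ∈ S, Function.eval i ⁻¹' A i) ∩
        (fun ω i => Y i ω) ⁻¹' (⋂ i ∈ S, Function.eval i ⁻¹' B i) := by
      ext ω
      simp only [Set.mem_iInter, Set.mem_inter_iff, Set.mem_preimage, Function.eval]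
      constructor
      · intro h
        exact ⟨fun i hi => ((hAB i hi) ▸ h i hi).1, fun i hi => ((hAB i hi) ▸ h i hi).2⟩
      · intro h i hi
        rw [hAB i hi]
        exact ⟨h.1 i hi, h.2 i hi⟩
    have h2 : ∀ i ∈ S, P (f i) = P (X i ⁻¹' A i) * P (Y i ⁻¹' B i) := by
      intro i hi
      rw [hAB i hi]
      exact (hXY.comp (measurable_pi_apply i)
        (measurable_pi_apply i)).measure_inter_preimage_eq_mul _ _ (hA i) (hB i)
    rw [h1, hXY.measure_inter_preimage_eq_mul _ _
      (Finset.measurableSet_biInter _ fun i _ => measurable_pi_apply i (hA i))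
      (Finset.measurableSet_biInter _ fun i _ => measurable_pi_apply i (hB i)),
      Finset.prod_congr rfl h2, Finset.prod_mul_distrib]
    simp only [Set.preimage_iInter]
    congr 1
    · exact hX.measure_inter_preimage_eq_mul S fun i _ => hA i
    · exact hY.measure_inter_preimage_eq_mul S fun i _ => hB i

lemma card_firstHalf (n : ℕ) : (firstHalf n).card = n / 2 := by
  rw [firstHalf, Fin.card_filter_val_lt]
  omega

lemma card_secondHalf (n : ℕ) : (secondHalf n).card = n - n / 2 := by
  have h := Finset.card_compl (firstHalf n)
  rw [card_firstHalf, Fintype.card_fin] at h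
  rw [← h]
  congr 1
  ext j
  simp [firstHalf, secondHalf]

namespace IsRegressionModel

variable {Ω : Type*} [MeasurableSpace Ω] {P : Measure Ω} {n : ℕ}
  {σ : ℝ≥0} {X : Fin n → Ω → Cube d} {ξ : Fin n → Ω → ℝ}

lemma measurable_comp_design (h : IsRegressionModel P σ X ξ) (j : Fin n) (g : Cube d → ℝ) :
    Measurable fun ω => g (X j ω) :=
  (measurable_of_finite g).comp (h.measurable_design j)

lemma integrable_comp_design [IsProbabilityMeasure P] (h : IsRegressionModel P σ X ξ) (j : Fin n) (g : Cube d → ℝ) :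
    Integrable (fun ω => g (X j ω)) P :=
  (Integrable.of_finite (f := g)).comp_measurable (h.measurable_design j)

lemma memLp_comp_design [IsProbabilityMeasure P] (h : IsRegressionModel P σ X ξ) (j : Fin n) (g : Cube d → ℝ)
    (p : ENNReal) : MemLp (fun ω => g (X j ω)) p P := by
  refine MemLp.of_bound (h.measurable_comp_design j g).aestronglyMeasurable (∑ x, |g x|)
    (ae_of_all _ fun ω => ?_)
  exact Finset.single_le_sum (f := fun x => |g x|) (fun x _ => abs_nonneg _) (Finset.mem_univ _)

lemma integral_comp_design (h : IsRegressionModel P σ X ξ) (j : Fin n) (g : Cube d → ℝ) :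
    ∫ ω, g (X j ω) ∂P = cubeMean g := by
  have h1 : ∫ ω, g (X j ω) ∂P = ∫ x, g x ∂(P.map (X j)) :=
    (integral_map (h.measurable_design j).aemeasurable
      (measurable_of_finite g).aestronglyMeasurable).symm
  rw [h1, h.law_design j, integral_fintype Integrable.of_finite, cubeMean, Finset.sum_div]
  refine Finset.sum_congr rfl fun x _ => ?_
  have : (uniformOn (Set.univ : Set (Cube d))).real {x} = 1 / 2 ^ d := by
    rw [measureReal_def, uniformOn_univ]
    simp
  rw [this, smul_eq_mul]
  ring

lemma indepFun_design_noise (h : IsRegressionModel P σ X ξ) (j : Fin n) :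
    IndepFun (X j) (ξ j) P :=
  h.indep_design_noise.comp (measurable_pi_apply j) (measurable_pi_apply j)

lemma iIndepFun_comp (h : IsRegressionModel P σ X ξ) {φ : Cube d × ℝ → ℝ} (hφ : Measurable φ) :
    iIndepFun (fun j ω => φ (X j ω, ξ j ω)) P :=
  (iIndepFun_prodMk h.indep_design h.indep_noise h.measurable_design h.measurable_noise
    h.indep_design_noise).comp (fun _ => φ) fun _ => hφ

lemma integral_design_mul_noise [IsProbabilityMeasure P] (h : IsRegressionModel P σ X ξ) (j : Fin n) (g : Cube d → ℝ) :
    ∫ ω, g (X j ω) * ξ j ω ∂P = 0 := by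
  have := ((h.indepFun_design_noise j).comp (measurable_of_finite g)
    measurable_id).integral_fun_mul_eq_mul_integral
    (h.measurable_comp_design j g).aestronglyMeasurable
    (h.measurable_noise j).aestronglyMeasurable
  simp only [Function.comp_def, id] at this
  rw [this, h.centered_noise j, mul_zero]

/-! ### Variance of the empirical Fourier coefficients -/

/-- From `x² ≤ 2eˣ + 2e⁻ˣ` and the moment generating function at `±1`. Only a constant depending on
`σ` is needed. -/
lemma integral_noise_sq_le (h : IsRegressionModel P σ X ξ) (j : Fin n) :
    ∫ ω, ξ j ω ^ 2 ∂P ≤ 4 * Real.exp (σ ^ 2 / 2) := by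
  have hs := h.subgaussian_noise j
  have hpos := hs.mgf_le 1
  have hneg := hs.mgf_le (-1)
  have ipos := hs.integrable_exp_mul 1
  have ineg := hs.integrable_exp_mul (-1)
  simp only [mgf] at hpos hneg
  calc ∫ ω, ξ j ω ^ 2 ∂P
      ≤ ∫ ω, (2 * Real.exp (1 * ξ j ω) + 2 * Real.exp (-1 * ξ j ω)) ∂P := by
        refine integral_mono_of_nonneg (ae_of_all _ fun ω => sq_nonneg _)
          ((ipos.const_mul 2).add (ineg.const_mul 2)) (ae_of_all _ fun ω => ?_)
        have h1 := Real.exp_pos (1 * ξ j ω)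
        have h2 := Real.exp_pos (-1 * ξ j ω)
        rcases le_total 0 (ξ j ω) with h0 | h0
        · have := Real.quadratic_le_exp_of_nonneg h0
          simp only [one_mul] at *
          linarith
        · have := Real.quadratic_le_exp_of_nonneg (neg_nonneg.mpr h0)
          simp only [neg_one_mul] at *
          linarith
    _ ≤ 4 * Real.exp (σ ^ 2 / 2) := by
        rw [integral_add (ipos.const_mul 2) (ineg.const_mul 2), integral_const_mul,
          integral_const_mul]
        norm_num at hpos hneg ⊢
        linarith

lemma integral_empiricalCoeff_sub_sq_le [IsProbabilityMeasure P] (h : IsRegressionModel P σ X ξ) (hn : 0 < n)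
    {f : Cube d → ℝ} (hf : ∀ x, f x ∈ Set.Icc (0 : ℝ) 1) (S : Finset (Fin d)) :
    Integrable (fun ω => (empiricalCoeff (sample X ξ f ω) S - fourierCoeff f S) ^ 2) P ∧
    ∫ ω, (empiricalCoeff (sample X ξ f ω) S - fourierCoeff f S) ^ 2 ∂P ≤
      (2 + 8 * Real.exp (σ ^ 2 / 2)) / ((n - n / 2 : ℕ) : ℝ) := by
  -- From `(f + ξ)² ≤ 2f² + 2ξ²`, with `f² ≤ 1` and the bound `4 exp(σ²/2)` on `𝔼ξ²`.
  set V := 2 + 8 * Real.exp ((σ : ℝ) ^ 2 / 2) with hV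
  set m : ℝ := ((n - n / 2 : ℕ) : ℝ) with hm
  have hm0 : 0 < m := by
    rw [hm]
    exact_mod_cast (by omega : 0 < n - n / 2)
  have hcard : ((secondHalf n).card : ℝ) = m := by rw [card_secondHalf]
  set φ : Cube d × ℝ → ℝ := fun z => (f z.1 + z.2) * character S z.1 with hφ
  set U : Fin n → Ω → ℝ := fun j ω => φ (X j ω, ξ j ω) with hU
  have mφ : Measurable φ := by
    have h1 : Measurable fun z : Cube d × ℝ => f z.1 := (measurable_of_finite f).comp measurable_fst
    have h2 : Measurable fun z : Cube d × ℝ => character S z.1 :=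
      (measurable_of_finite (character S)).comp measurable_fst
    exact (h1.add measurable_snd).mul h2
  have hUL : ∀ j, MemLp (U j) 2 P := by
    intro j
    have h1 : MemLp (fun ω => f (X j ω) + ξ j ω) 2 P :=
      (h.memLp_comp_design j f 2).add (by exact_mod_cast (h.subgaussian_noise j).memLp 2)
    refine h1.of_le (mφ.comp ((h.measurable_design j).prodMk
      (h.measurable_noise j))).aestronglyMeasurable (ae_of_all _ fun ω => ?_)
    simp [hU, hφ, abs_character]
  have hUE : ∀ j, ∫ ω, U j ω ∂P = fourierCoeff f S := by
    intro j
    have h1 := h.integral_comp_design j (fun x => f x * character S x)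
    have h2 := h.integral_design_mul_noise j (character S)
    have h3 : ∀ ω, U j ω = f (X j ω) * character S (X j ω) + character S (X j ω) * ξ j ω :=
      fun ω => by simp only [hU, hφ]; ring
    have h4 : Integrable (fun ω => character S (X j ω) * ξ j ω) P := by
      refine (h.subgaussian_noise j).integrable.mono
        ((h.measurable_comp_design j _).mul (h.measurable_noise j)).aestronglyMeasurable
        (ae_of_all _ fun ω => ?_)
      simp [abs_character]
    simp_rw [h3]
    rw [integral_add (h.integrable_comp_design j fun x => f x * character S x) h4, h1, h2, add_zero]
    rfl
  have hUV : ∀ j, variance (U j) P ≤ V := by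
    intro j
    refine (variance_le_expectation_sq (hUL j).aestronglyMeasurable).trans ?_
    have h5 : Integrable (fun ω => ξ j ω ^ 2) P := MemLp.integrable_sq
      (by exact_mod_cast (h.subgaussian_noise j).memLp 2)
    calc ∫ ω, (U j ^ 2) ω ∂P ≤ ∫ ω, (2 + 2 * ξ j ω ^ 2) ∂P := by
          refine integral_mono_of_nonneg (ae_of_all _ fun ω => sq_nonneg _)
            ((integrable_const _).add (h5.const_mul 2)) (ae_of_all _ fun ω => ?_)
          simp only [hU, hφ, Pi.pow_apply, mul_pow, character_sq, mul_one]
          obtain ⟨h6, h7⟩ := hf (X j ω)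
          nlinarith [sq_nonneg (f (X j ω) - ξ j ω)]
      _ ≤ V := by
          rw [integral_add (integrable_const _) (h5.const_mul 2), integral_const_mul]
          have := h.integral_noise_sq_le j
          simp
          linarith
  have hsum : ∀ ω, (empiricalCoeff (sample X ξ f ω) S - fourierCoeff f S) ^ 2 =
      m⁻¹ ^ 2 * ((∑ j ∈ secondHalf n, U j) ω - ∫ ω, (∑ j ∈ secondHalf n, U j) ω ∂P) ^ 2 := by
    intro ω
    simp only [Finset.sum_apply]
    rw [integral_finsetSum _ fun j _ => (hUL j).integrable (by norm_num)]
    simp_rw [hUE]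
    rw [Finset.sum_const, nsmul_eq_mul, hcard, ← mul_pow]
    congr 1
    rw [mul_sub, inv_mul_cancel_left₀ hm0.ne', empiricalCoeff]
    simp only [hU, hφ, sample, hm]
    ring
  have hL : MemLp (∑ j ∈ secondHalf n, U j) 2 P := memLp_finsetSum' _ fun j _ => hUL j
  simp_rw [hsum]
  refine ⟨((hL.sub (memLp_const _)).integrable_sq).const_mul _, ?_⟩
  rw [integral_const_mul, ← variance_eq_integral hL.aestronglyMeasurable.aemeasurable,
    IndepFun.variance_sum (fun j _ => hUL j)
      fun i _ j _ hij => (h.iIndepFun_comp mφ).indepFun hij]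
  calc m⁻¹ ^ 2 * ∑ j ∈ secondHalf n, variance (U j) P ≤ m⁻¹ ^ 2 * ∑ j ∈ secondHalf n, V := by
        gcongr with j
        exact hUV j
    _ = V / m := by
        rw [Finset.sum_const, nsmul_eq_mul, hcard]
        field_simp

end IsRegressionModel

/-! ### Concentration of the estimated influences -/

/-- The indicator of the half-cube `{x : x i = b}`. -/
def halfCubeIndicator (i : Fin d) (b : Bool) (x : Cube d) : ℝ := if x i = b then 1 else 0

lemma halfCubeIndicator_nonneg (i : Fin d) (b : Bool) (x : Cube d) :
    0 ≤ halfCubeIndicator i b x := by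
  unfold halfCubeIndicator
  split_ifs <;> norm_num

lemma halfCubeIndicator_le_one (i : Fin d) (b : Bool) (x : Cube d) :
    halfCubeIndicator i b x ≤ 1 := by
  unfold halfCubeIndicator
  split_ifs <;> norm_num

lemma cubeMean_halfCubeIndicator (i : Fin d) (b : Bool) :
    cubeMean (halfCubeIndicator i b) = 1 / 2 := by
  have h1 := cubeMean_flipAt i (halfCubeIndicator i b)
  have h2 : cubeMean (fun x => halfCubeIndicator i b x + halfCubeIndicator i b (flipAt i x)) = 1 := by
    rw [← cubeMean_const (d := d) 1]
    congr 1
    funext x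
    cases hx : x i <;> cases b <;> simp [halfCubeIndicator, flipAt, hx]
  rw [cubeMean_add, h1] at h2
  have h3 : cubeMean (fun x => halfCubeIndicator i b x) = cubeMean (halfCubeIndicator i b) := rfl
  linarith

/-- The mean of `f` over the half-cube `{x : x i = b}`. -/
def halfCubeMean (f : Cube d → ℝ) (i : Fin d) (b : Bool) : ℝ :=
  2 * cubeMean fun x => f x * halfCubeIndicator i b x

lemma halfCubeMean_mem_Icc {f : Cube d → ℝ} (hf : ∀ x, f x ∈ Set.Icc (0 : ℝ) 1) (i : Fin d)
    (b : Bool) : halfCubeMean f i b ∈ Set.Icc (0 : ℝ) 1 := by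
  have h1 := cubeMean_halfCubeIndicator i b
  have h2 : 0 ≤ cubeMean fun x => f x * halfCubeIndicator i b x :=
    cubeMean_nonneg fun x => mul_nonneg (hf x).1 (halfCubeIndicator_nonneg i b x)
  have h3 : cubeMean (fun x => f x * halfCubeIndicator i b x) ≤
      cubeMean (halfCubeIndicator i b) :=
    cubeMean_mono fun x => mul_le_of_le_one_left (halfCubeIndicator_nonneg i b x) (hf x).2
  constructor <;> unfold halfCubeMean <;> linarith

/-- Monotonicity removes the absolute value, so the influence becomes linear in `f` and can be
estimated by averages. -/
lemma halfCubeMean_sub_eq_influenceOne {f : Cube d → ℝ} (hf : Monotone f) (i : Fin d) :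
    halfCubeMean f i true - halfCubeMean f i false = influenceOne f i := by
  have h1 : influenceOne f i = cubeMean (fun x => f x * character {i} x) +
      cubeMean (fun x => f (flipAt i x) * character {i} (flipAt i x)) := by
    rw [influenceOne, ← cubeMean_add]
    congr 1
    funext x
    have h2 : 0 ≤ discreteDeriv i f x :=
      sub_nonneg.mpr (hf (update_le_update_iff.mpr ⟨Bool.false_le _, fun _ _ => le_rfl⟩))
    rw [abs_of_nonneg h2, discreteDeriv_eq, character_singleton_flipAt]
    ring
  rw [h1, cubeMean_flipAt i (fun x => f x * character {i} x), halfCubeMean, halfCubeMean,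
    ← mul_sub, ← cubeMean_sub, ← two_mul]
  congr 2
  funext x
  cases hx : x i <;> simp [halfCubeIndicator, character, hx]
  norm_num

lemma hasSubgaussianMGF_one_of_abs_le_one {Ω : Type*} [MeasurableSpace Ω] {P : Measure Ω}
    [IsProbabilityMeasure P] {Z : Ω → ℝ} (hm : Measurable Z) (hZ : ∀ ω, |Z ω| ≤ 1)
    (h0 : ∫ ω, Z ω ∂P = 0) : HasSubgaussianMGF Z 1 P := by
  have := hasSubgaussianMGF_of_mem_Icc_of_integral_eq_zero (a := -1) (b := 1) hm.aemeasurable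
    (ae_of_all P fun ω => abs_le.mp (hZ ω)) h0
  convert this using 1
  ext
  norm_num

/-- Thinning a sub-Gaussian variable by an independent `{0, 1}`-valued one. -/
lemma HasSubgaussianMGF.indicator_mul {Ω : Type*} [MeasurableSpace Ω] {P : Measure Ω}
    [IsProbabilityMeasure P] {Z B : Ω → ℝ} {v : ℝ≥0} (hZ : HasSubgaussianMGF Z v P)
    (mB : Measurable B) (hB : ∀ ω, B ω = 0 ∨ B ω = 1) (hBZ : IndepFun B Z P) :
    HasSubgaussianMGF (fun ω => B ω * Z ω) v P := by
  -- With `p = 𝔼B`, independence turns this identity into the moment generating function `(1 - p) +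
  -- p · mgf Z`, an average of two numbers that are both at most `exp(v t²/2)`.
  have hexp : ∀ t ω, Real.exp (t * (B ω * Z ω)) = (1 - B ω) + B ω * Real.exp (t * Z ω) := by
    intro t ω
    rcases hB ω with h | h <;> simp [h]
  have iB : Integrable B P := Integrable.of_bound mB.aestronglyMeasurable 1
    (ae_of_all _ fun ω => by rcases hB ω with h | h <;> simp [h])
  have iBZ : ∀ t, Integrable (fun ω => B ω * Real.exp (t * Z ω)) P := fun t =>
    (hZ.integrable_exp_mul t).bdd_mul (c := 1) mB.aestronglyMeasurable
      (ae_of_all _ fun ω => by rcases hB ω with h | h <;> simp [h])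
  refine ⟨fun t => ?_, fun t => ?_⟩
  · simp_rw [hexp]
    exact ((integrable_const 1).sub iB).add (iBZ t)
  · have hind : ∫ ω, B ω * Real.exp (t * Z ω) ∂P = (∫ ω, B ω ∂P) * mgf Z P t := by
      have := (hBZ.comp measurable_id (by fun_prop : Measurable fun z : ℝ =>
        Real.exp (t * z))).integral_fun_mul_eq_mul_integral mB.aestronglyMeasurable
        (hZ.integrable_exp_mul t).aestronglyMeasurable
      exact this
    have hp0 : 0 ≤ ∫ ω, B ω ∂P :=
      integral_nonneg fun ω => by rcases hB ω with h | h <;> simp [h]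
    have hp1 : ∫ ω, B ω ∂P ≤ 1 := by
      have := integral_mono iB (integrable_const 1) (μ := P)
        (fun ω => by rcases hB ω with h | h <;> simp [h])
      simpa using this
    have hone : 1 ≤ Real.exp (v * t ^ 2 / 2) := Real.one_le_exp (by positivity)
    have iB' : Integrable (fun ω => 1 - B ω) P := (integrable_const 1).sub iB
    simp only [mgf, hexp]
    rw [integral_add iB' (iBZ t), integral_sub (integrable_const 1) iB,
      hind]
    have := hZ.mgf_le t
    simp only [integral_const, probReal_univ, smul_eq_mul, mul_one]
    nlinarith

namespace IsRegressionModel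

variable {Ω : Type*} [MeasurableSpace Ω] {P : Measure Ω} {n : ℕ}
  {σ : ℝ≥0} {X : Fin n → Ω → Cube d} {ξ : Fin n → Ω → ℝ}

lemma measureReal_le_sum_firstHalf (h : IsRegressionModel P σ X ξ) {φ : Cube d × ℝ → ℝ}
    (mφ : Measurable φ) {v : ℝ≥0} (hφ : ∀ j, HasSubgaussianMGF (fun ω => φ (X j ω, ξ j ω)) v P)
    {t : ℝ} (ht : 0 ≤ t) :
    P.real {ω | t ≤ ∑ j ∈ firstHalf n, φ (X j ω, ξ j ω)} ≤
      Real.exp (-t ^ 2 / (2 * ((n / 2 : ℕ) * v))) := by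
  have := HasSubgaussianMGF.measure_sum_ge_le_of_iIndepFun (h.iIndepFun_comp mφ)
    (s := firstHalf n) (c := fun _ => v) (fun j _ => hφ j) ht
  simpa [card_firstHalf] using this

/-- The event on which the average over a half-cube fails to be accurate. -/
def averageFailure (X : Fin n → Ω → Cube d) (ξ : Fin n → Ω → ℝ) (f : Cube d → ℝ) (δ : ℝ)
    (i : Fin d) (b : Bool) : Set Ω :=
  {ω | δ / 8 < |conditionalAverage (sample X ξ f ω) i b - halfCubeMean f i b|}

/-- The error of the average is a centred sum `∑ φ` over a random count `T`. If `T > N/4` and `|∑ φ|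
< Nδ/32`, the quotient is below `δ/8`. Three one-sided tail bounds cover the complement, where the
value `0` of an empty average may also occur. -/
lemma measureReal_averageFailure_le [IsProbabilityMeasure P] (h : IsRegressionModel P σ X ξ) (hn : 2 ≤ n) {f : Cube d → ℝ}
    (hf : ∀ x, f x ∈ Set.Icc (0 : ℝ) 1) {δ : ℝ} (hδ : 0 < δ) (hδ1 : δ ≤ 1) (i : Fin d) (b : Bool) :
    P.real (averageFailure X ξ f δ i b) ≤
      3 * Real.exp (-((n / 2 : ℕ) * δ ^ 2 / (2048 * (1 + σ) ^ 2))) := by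
  set m := halfCubeMean f i b with hm
  set e := halfCubeIndicator i b with he
  set N : ℝ := ((n / 2 : ℕ) : ℝ) with hN
  have hN0 : 0 < N := by
    rw [hN]
    exact_mod_cast (by omega : 0 < n / 2)
  obtain ⟨hm0, hm1⟩ := halfCubeMean_mem_Icc hf i b
  rw [← hm] at hm0 hm1
  set φ : Cube d × ℝ → ℝ := fun z => (f z.1 - m) * e z.1 + e z.1 * z.2 with hφ
  set ψ : Cube d × ℝ → ℝ := fun z => 1 / 2 - e z.1 with hψ
  have me : Measurable fun z : Cube d × ℝ => e z.1 := (measurable_of_finite e).comp measurable_fst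
  have mfst : Measurable fun z : Cube d × ℝ => (f z.1 - m) * e z.1 :=
    (measurable_of_finite fun x => (f x - m) * e x).comp measurable_fst
  have mφ : Measurable φ := mfst.add (me.mul measurable_snd)
  have mψ : Measurable ψ := measurable_const.sub me
  have he1 : cubeMean (fun x => e x) = 1 / 2 := cubeMean_halfCubeIndicator i b
  have he01 : ∀ x, 0 ≤ e x ∧ e x ≤ 1 := fun x =>
    ⟨halfCubeIndicator_nonneg i b x, halfCubeIndicator_le_one i b x⟩
  have hφs : ∀ j, HasSubgaussianMGF (fun ω => φ (X j ω, ξ j ω)) ((1 + σ) ^ 2) P := by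
    intro j
    have h1 : HasSubgaussianMGF (fun ω => (f (X j ω) - m) * e (X j ω)) 1 P := by
      refine hasSubgaussianMGF_one_of_abs_le_one
        (h.measurable_comp_design j fun x => (f x - m) * e x) (fun ω => ?_) ?_
      · rw [abs_mul]
        refine mul_le_one₀ ?_ (abs_nonneg _) ?_
        · obtain ⟨h2, h3⟩ := hf (X j ω)
          exact abs_le.mpr ⟨by linarith, by linarith⟩
        · rw [abs_of_nonneg (he01 _).1]
          exact (he01 _).2
      · rw [h.integral_comp_design j fun x => (f x - m) * e x]
        simp_rw [sub_mul]
        rw [cubeMean_sub, cubeMean_const_mul, he1, hm, halfCubeMean]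
        ring
    have h2 : HasSubgaussianMGF (fun ω => e (X j ω) * ξ j ω) (σ ^ 2) P := by
      refine HasSubgaussianMGF.indicator_mul (h.subgaussian_noise j) (h.measurable_comp_design j e)
        (fun ω => ?_) ((h.indepFun_design_noise j).comp (measurable_of_finite e) measurable_id)
      simp only [he, halfCubeIndicator]
      split_ifs <;> simp
    -- The design part and the noise part are dependent, so the standard deviation proxies `1` and
    -- `σ` add up.
    have h3 := h1.add h2
    rwa [NNReal.sqrt_one, NNReal.sqrt_sq] at h3
  have hφn : ∀ j, HasSubgaussianMGF (fun ω => -φ (X j ω, ξ j ω)) ((1 + σ) ^ 2) P :=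
    fun j => (hφs j).neg
  have hψs : ∀ j, HasSubgaussianMGF (fun ω => ψ (X j ω, ξ j ω)) 1 P := by
    intro j
    refine hasSubgaussianMGF_one_of_abs_le_one (mψ.comp ((h.measurable_design j).prodMk
      (h.measurable_noise j))) (fun ω => ?_) ?_
    · obtain ⟨h2, h3⟩ := he01 (X j ω)
      exact abs_le.mpr ⟨by simp only [hψ]; linarith, by simp only [hψ]; linarith⟩
    · rw [h.integral_comp_design j fun x => 1 / 2 - e x, cubeMean_sub, he1, cubeMean_const]
      norm_num
  have hσ : (1 : ℝ) ≤ (1 + σ) ^ 2 := one_le_pow₀ (by simp)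
  have b1 := h.measureReal_le_sum_firstHalf mφ hφs (t := N * δ / 32) (by positivity)
  have b2 := h.measureReal_le_sum_firstHalf mφ.neg hφn (t := N * δ / 32) (by positivity)
  have b3 := h.measureReal_le_sum_firstHalf mψ hψs (t := N / 4) (by positivity)
  have e1 : -(N * δ / 32) ^ 2 / (2 * (N * (((1 + σ) ^ 2 : ℝ≥0) : ℝ))) =
      -(N * δ ^ 2 / (2048 * (1 + σ) ^ 2)) := by
    push_cast
    field_simp
    norm_num
  have e3 : -(N / 4) ^ 2 / (2 * (N * ((1 : ℝ≥0) : ℝ))) ≤ -(N * δ ^ 2 / (2048 * (1 + σ) ^ 2)) := by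
    have h1 : -(N / 4) ^ 2 / (2 * (N * ((1 : ℝ≥0) : ℝ))) = -(N / 32) := by
      push_cast
      field_simp
      norm_num
    rw [h1, neg_le_neg_iff, div_le_div_iff₀ (by positivity) (by norm_num)]
    have h2 : δ ^ 2 ≤ 1 := pow_le_one₀ hδ.le hδ1
    nlinarith
  rw [← hN, e1] at b1 b2
  rw [← hN] at b3
  replace b3 := b3.trans (Real.exp_le_exp.mpr e3)
  have hsub : averageFailure X ξ f δ i b ⊆
      {ω | N * δ / 32 ≤ ∑ j ∈ firstHalf n, φ (X j ω, ξ j ω)} ∪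
        {ω | N * δ / 32 ≤ ∑ j ∈ firstHalf n, -φ (X j ω, ξ j ω)} ∪
          {ω | N / 4 ≤ ∑ j ∈ firstHalf n, ψ (X j ω, ξ j ω)} := by
    intro ω hω
    by_contra hcon
    simp only [Set.mem_union, Set.mem_ofPred_eq, not_or, not_le, Finset.sum_neg_distrib] at hcon
    obtain ⟨⟨c1, c2⟩, c3⟩ := hcon
    set T := ∑ j ∈ firstHalf n, e (X j ω) with hT
    have hT1 : N / 4 < T := by
      simp only [hψ, Finset.sum_sub_distrib, Finset.sum_const, card_firstHalf, nsmul_eq_mul,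
        ← hN, ← hT] at c3
      linarith
    have hT0 : 0 < T := lt_trans (by positivity) hT1
    have havg : conditionalAverage (sample X ξ f ω) i b - m =
        (∑ j ∈ firstHalf n, φ (X j ω, ξ j ω)) / T := by
      have h1 : conditionalAverage (sample X ξ f ω) i b =
          (∑ j ∈ firstHalf n, (f (X j ω) + ξ j ω) * e (X j ω)) / T := rfl
      rw [h1, eq_div_iff hT0.ne', sub_mul, div_mul_cancel₀ _ hT0.ne', hT, Finset.mul_sum,
        ← Finset.sum_sub_distrib]
      refine Finset.sum_congr rfl fun j _ => ?_
      simp only [hφ]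
      ring
    simp only [averageFailure, Set.mem_ofPred_eq, ← hm, havg, abs_div, abs_of_pos hT0,
      lt_div_iff₀ hT0] at hω
    have h4 := abs_lt.mpr ⟨by linarith, c1⟩
    nlinarith
  refine (measureReal_mono hsub).trans ((measureReal_union_le _ _).trans ?_)
  have := measureReal_union_le (μ := P) {ω | N * δ / 32 ≤ ∑ j ∈ firstHalf n, φ (X j ω, ξ j ω)}
    {ω | N * δ / 32 ≤ ∑ j ∈ firstHalf n, -φ (X j ω, ξ j ω)}
  simp only [Pi.neg_apply] at b2
  linarith

/-- With high probability all the influences are estimated accurately. -/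
lemma measureReal_exists_lt_abs_estimatedInfluence_sub_le [IsProbabilityMeasure P] (h : IsRegressionModel P σ X ξ)
    (hn : 2 ≤ n) {f : Cube d → ℝ} (hf : ∀ x, f x ∈ Set.Icc (0 : ℝ) 1) (hmono : Monotone f) {δ : ℝ}
    (hδ : 0 < δ) (hδ1 : δ ≤ 1) :
    P.real {ω | ∃ i, δ / 4 < |estimatedInfluence (sample X ξ f ω) i - influenceOne f i|} ≤
      6 * d * Real.exp (-((n / 2 : ℕ) * δ ^ 2 / (2048 * (1 + σ) ^ 2))) := by
  have hsub : {ω | ∃ i, δ / 4 < |estimatedInfluence (sample X ξ f ω) i - influenceOne f i|} ⊆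
      ⋃ i, ⋃ b, averageFailure X ξ f δ i b := by
    rintro ω ⟨i, hi⟩
    by_contra hcon
    simp only [Set.mem_iUnion, averageFailure, Set.mem_ofPred_eq, not_exists, not_lt] at hcon
    have h1 := abs_le.mp (hcon i true)
    have h2 := abs_le.mp (hcon i false)
    refine hi.not_ge (abs_le.mpr ?_)
    rw [← halfCubeMean_sub_eq_influenceOne hmono, estimatedInfluence]
    constructor <;> linarith
  refine (measureReal_mono hsub).trans ((measureReal_iUnion_fintype_le _).trans ?_)
  set B := Real.exp (-((n / 2 : ℕ) * δ ^ 2 / (2048 * (1 + σ) ^ 2)))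
  calc ∑ i, P.real (⋃ b, averageFailure X ξ f δ i b) ≤ ∑ _i : Fin d, 6 * B := by
        refine Finset.sum_le_sum fun i _ => (measureReal_iUnion_fintype_le _).trans ?_
        rw [Fintype.sum_bool]
        have h1 := h.measureReal_averageFailure_le hn hf hδ hδ1 i true
        have h2 := h.measureReal_averageFailure_le hn hf hδ hδ1 i false
        linarith
    _ = 6 * d * B := by
        simp
        ring

/-! ### The risk bound -/

lemma risk_fourierEstimator_le_one [IsProbabilityMeasure P] (γ c₀ : ℝ) {f : Cube d → ℝ}
    (hf : ∀ x, f x ∈ Set.Icc (0 : ℝ) 1) : risk P X ξ (fourierEstimator γ c₀) f ≤ 1 := by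
  have := integral_mono_of_nonneg (μ := P) (ae_of_all _ fun ω => sqNorm_nonneg _)
    (integrable_const 1) (ae_of_all _ fun ω =>
      sqNorm_fourierEstimator_sub_le_one γ c₀ (sample X ξ f ω) hf)
  simpa [risk] using this

/-- The non-asymptotic risk bound: variance, bias, and the probability of misselection. -/
lemma risk_fourierEstimator_le [IsProbabilityMeasure P] (h : IsRegressionModel P σ X ξ) (hn : 2 ≤ n) {γ : ℝ} (hγ : 0 < γ)
    (c₀ : ℝ) {K : ℝ} (hK : 0 < K) {f : Cube d → ℝ} (hf : f ∈ monotoneClass d K) {D : ℕ}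
    (hD : degreeCutoff γ c₀ n = D) {δ : ℝ} (hδ : influenceCutoff γ c₀ n = δ) :
    risk P X ξ (fourierEstimator γ c₀) f ≤
      ((4 * K / D + 1) / δ * Real.exp 1) ^ D *
          ((2 + 8 * Real.exp (σ ^ 2 / 2)) / ((n - n / 2 : ℕ) : ℝ)) +
        (totalInfluenceTwo f / (4 * D) + 3 ^ D * √δ * K / 4) +
        6 * d * Real.exp (-((n / 2 : ℕ) * δ ^ 2 / (2048 * (1 + σ) ^ 2))) := by
  obtain ⟨hf01, hmono, hfK⟩ := hf
  have hD0 : 0 < D := hD ▸ degreeCutoff_pos γ c₀ n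
  have hδ0 : 0 < δ := hδ ▸ influenceCutoff_pos γ c₀ n
  have hδ1 : δ ≤ 1 := by
    rw [← hδ, influenceCutoff, Real.exp_le_one_iff]
    have : (0 : ℝ) ≤ degreeCutoff γ c₀ n := Nat.cast_nonneg _
    nlinarith
  set bad : Set Ω :=
    {ω | ∃ i, δ / 4 < |estimatedInfluence (sample X ξ f ω) i - influenceOne f i|} with hbad
  set 𝒮 := influentialSets f (δ / 4) D with hS
  set bias := totalInfluenceTwo f / (4 * D) + 3 ^ D * √δ * K / 4 with hbias
  have hI2 := totalInfluenceTwo_nonneg f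
  have hbias0 : 0 ≤ bias := by positivity
  have hcoef := fun S => h.integral_empiricalCoeff_sub_sq_le (by omega) hf01 S
  have hint1 : Integrable (fun ω => ∑ S ∈ 𝒮,
      (empiricalCoeff (sample X ξ f ω) S - fourierCoeff f S) ^ 2) P :=
    integrable_finsetSum _ fun S _ => (hcoef S).1
  -- A measurable hull of the bad event has the same probability; with an integrable majorant, no
  -- measurability of the event or of the loss is needed.
  have hint2 : Integrable ((toMeasurable P bad).indicator fun _ => (1 : ℝ)) P :=
    (integrable_const 1).indicator (measurableSet_toMeasurable P bad)
  have hint3 : Integrable (fun ω => ∑ S ∈ 𝒮,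
      (empiricalCoeff (sample X ξ f ω) S - fourierCoeff f S) ^ 2 + bias) P :=
    hint1.add (integrable_const bias)
  have hpoint : ∀ ω, sqNorm (fun x => fourierEstimator γ c₀ (sample X ξ f ω) x - f x) ≤
      (∑ S ∈ 𝒮, (empiricalCoeff (sample X ξ f ω) S - fourierCoeff f S) ^ 2 + bias) +
        (toMeasurable P bad).indicator (fun _ => (1 : ℝ)) ω := by
    intro ω
    have hsum0 : 0 ≤ ∑ S ∈ 𝒮, (empiricalCoeff (sample X ξ f ω) S - fourierCoeff f S) ^ 2 :=
      Finset.sum_nonneg fun _ _ => sq_nonneg _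
    by_cases hω : ω ∈ bad
    · rw [Set.indicator_of_mem (subset_toMeasurable P bad hω)]
      have := sqNorm_fourierEstimator_sub_le_one γ c₀ (sample X ξ f ω) hf01
      linarith
    · have h1 : 0 ≤ (toMeasurable P bad).indicator (fun _ => (1 : ℝ)) ω :=
        Set.indicator_nonneg (fun _ _ => zero_le_one) ω
      have h2 := sqNorm_fourierEstimator_sub_le_of_abs_sub_le γ c₀ (sample X ξ f ω) hf01 (by
        intro i
        rw [hδ]
        by_contra hcon
        exact hω ⟨i, not_le.mp hcon⟩)
      rw [hδ, hD] at h2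
      have h3 : 3 ^ D * √δ * totalInfluenceOne f / 4 ≤ 3 ^ D * √δ * K / 4 := by gcongr
      linarith
  have hrisk := integral_mono_of_nonneg (μ := P) (ae_of_all _ fun ω => sqNorm_nonneg _)
    (hint3.add hint2) (ae_of_all _ hpoint)
  refine hrisk.trans ?_
  have hv0 : 0 ≤ (2 + 8 * Real.exp ((σ : ℝ) ^ 2 / 2)) / ((n - n / 2 : ℕ) : ℝ) := by positivity
  have i1 : ∫ ω, ∑ S ∈ 𝒮, (empiricalCoeff (sample X ξ f ω) S - fourierCoeff f S) ^ 2 ∂P ≤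
      ((4 * K / D + 1) / δ * Real.exp 1) ^ D *
          ((2 + 8 * Real.exp (σ ^ 2 / 2)) / ((n - n / 2 : ℕ) : ℝ)) := by
    rw [integral_finsetSum _ fun S _ => (hcoef S).1]
    refine (Finset.sum_le_sum fun S _ => (hcoef S).2).trans ?_
    rw [Finset.sum_const, nsmul_eq_mul]
    exact mul_le_mul_of_nonneg_right (card_influentialSets_le hK hfK hδ0 hδ1 hD0) hv0
  have i2 : ∫ ω, (toMeasurable P bad).indicator (fun _ => (1 : ℝ)) ω ∂P = P.real bad := by
    rw [integral_indicator_const _ (measurableSet_toMeasurable P bad), smul_eq_mul, mul_one,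
      measureReal_def, measure_toMeasurable, measureReal_def]
  have i3 := h.measureReal_exists_lt_abs_estimatedInfluence_sub_le hn hf01 hmono hδ0 hδ1
  rw [integral_add' hint3 hint2,
    integral_add hint1 (integrable_const bias), i2]
  simp only [integral_const, probReal_univ, smul_eq_mul, one_mul]
  linarith

end IsRegressionModel

/-! ### Size of the tuning parameters -/

/-- Completing the square gives `√(L² - c₀L) ≤ L - c₀/2`, and rounding up costs at most `√γ` after
scaling. For the lower bound, `L ≥ 2c₀` gives `L² - c₀L ≥ L²/2`. -/
lemma degreeCutoff_bounds {γ c₀ : ℝ} (hγ : 0 < γ) (hc₀ : 0 < c₀) {n : ℕ} {L : ℝ} (hL : 2 * c₀ ≤ L)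
    (hLn : Real.log n = L ^ 2) :
    L ≤ √(2 * γ) * degreeCutoff γ c₀ n ∧ √γ * degreeCutoff γ c₀ n ≤ L - (c₀ / 2 - √γ) := by
  have hL0 : 0 < L := by linarith
  have hsqrt : √(Real.log n) = L := by rw [hLn, Real.sqrt_sq hL0.le]
  have hmax : max (Real.log n - c₀ * √(Real.log n)) 0 = L ^ 2 - c₀ * L := by
    rw [hsqrt, hLn]
    exact max_eq_left (by nlinarith)
  have hγ' : 0 < √γ := Real.sqrt_pos.mpr hγ
  rw [degreeCutoff, hmax]
  set a := √((L ^ 2 - c₀ * L) / γ) with ha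
  have ha1 : √γ * a ≤ L - c₀ / 2 := by
    rw [ha, ← Real.sqrt_mul hγ.le, mul_div_cancel₀ _ hγ.ne']
    exact Real.sqrt_le_iff.mpr ⟨by linarith, by nlinarith⟩
  have ha2 : L ≤ √(2 * γ) * a := by
    rw [ha, ← Real.sqrt_mul (by positivity)]
    refine Real.le_sqrt_of_sq_le ?_
    have : 2 * γ * ((L ^ 2 - c₀ * L) / γ) = 2 * (L ^ 2 - c₀ * L) := by field_simp
    rw [this]
    nlinarith
  have hceil : a ≤ (⌈a⌉₊ : ℝ) := Nat.le_ceil a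
  have hceil' : (⌈a⌉₊ : ℝ) < a + 1 := Nat.ceil_lt_add_one (Real.sqrt_nonneg _)
  rw [Nat.cast_max, Nat.cast_one]
  constructor
  · refine ha2.trans (mul_le_mul_of_nonneg_left ?_ (Real.sqrt_nonneg _))
    exact hceil.trans (le_max_left _ _)
  · have : max (⌈a⌉₊ : ℝ) 1 ≤ a + 1 :=
      max_le hceil'.le (by linarith [Real.sqrt_nonneg ((L ^ 2 - c₀ * L) / γ)])
    nlinarith

lemma variance_term_le {γ A L e K D δ : ℝ} {k : ℕ} (hγ : 0 < γ) (hA : A = 4 * √(2 * γ) + 1)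
    (he : e = (Real.log A + 1) / √γ + 1) (heL : e ≤ L) (hk : (k : ℝ) = D) (hD : 0 < D)
    (hLD : L ≤ √(2 * γ) * D) (hDL : √γ * D ≤ L - e) (hδ : δ = Real.exp (-γ * D)) (hK : 0 < K)
    (hKL : K ≤ L) :
    ((4 * K / D + 1) / δ * Real.exp 1) ^ k ≤ Real.exp (L ^ 2 - L) := by
  have hs : 0 < √γ := Real.sqrt_pos.mpr hγ
  have hA1 : 1 ≤ A := by rw [hA]; linarith [Real.sqrt_nonneg (2 * γ)]
  have hA0 : 0 < A := by linarith
  have hlogA : 0 ≤ Real.log A := Real.log_nonneg hA1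
  have he0 : 0 < e := by rw [he]; positivity
  have hbase : 4 * K / D + 1 ≤ A := by
    rw [hA, add_le_add_iff_right, div_le_iff₀ hD]
    linarith
  have hAexp : A / δ * Real.exp 1 = Real.exp (Real.log A + γ * D + 1) := by
    rw [Real.exp_add, Real.exp_add, Real.exp_log hA0, hδ, neg_mul, Real.exp_neg, div_inv_eq_mul]
  have hδ0 : 0 < δ := hδ ▸ Real.exp_pos _
  calc ((4 * K / D + 1) / δ * Real.exp 1) ^ k ≤ (A / δ * Real.exp 1) ^ k := by gcongr
    _ = Real.exp (D * (Real.log A + 1) + γ * D ^ 2) := by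
        rw [hAexp, ← Real.exp_nat_mul, hk]
        congr 1
        ring
    _ ≤ Real.exp (L ^ 2 - L) := by
        -- By the choice of `e`, `log A + 1 = √γ (e - 1)`, so the exponent is at most `L(e - 1) + (L
        -- - e)² = L² - L - e(L - e)`.
        rw [Real.exp_le_exp]
        have h1 : γ * D ^ 2 ≤ (L - e) ^ 2 := by
          have h2 : γ * D ^ 2 = (√γ * D) ^ 2 := by rw [mul_pow, Real.sq_sqrt hγ.le]
          rw [h2]
          gcongr
        have h3 : D * (Real.log A + 1) ≤ L * (e - 1) := by
          have h4 : Real.log A + 1 = √γ * (e - 1) := by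
            rw [he]
            field_simp
            ring
          have he1 : 0 ≤ e - 1 := by rw [he, add_sub_cancel_right]; positivity
          rw [h4, ← mul_assoc, mul_comm D]
          exact mul_le_mul_of_nonneg_right (by linarith) he1
        nlinarith

lemma low_influence_term_le {γ L D δ K c : ℝ} {k : ℕ} (hγ : 2 * Real.log 3 < γ)
    (hk : (k : ℝ) = D) (hLD : L ≤ √(2 * γ) * D) (hδ : δ = Real.exp (-γ * D)) (hK : 0 < K)
    (hKL : K ≤ L) (hc : c = (γ / 2 - Real.log 3) / √(2 * γ) / 2) :
    3 ^ k * √δ * K / 4 ≤ c⁻¹ * Real.exp (-c * L) := by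
  have h3 : 0 < Real.log 3 := Real.log_pos (by norm_num)
  have hγ0 : 0 < γ := by linarith
  have hs : 0 < √(2 * γ) := Real.sqrt_pos.mpr (by linarith)
  have hκ : 0 < γ / 2 - Real.log 3 := by linarith
  have hc0 : 0 < c := by rw [hc]; positivity
  have h1 : (3 : ℝ) ^ k * √δ = Real.exp (-(γ / 2 - Real.log 3) * D) := by
    have h4 : (3 : ℝ) ^ k = Real.exp (D * Real.log 3) := by
      rw [← hk, Real.exp_nat_mul, Real.exp_log (by norm_num)]
    rw [h4, hδ, ← Real.exp_half, ← Real.exp_add]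
    congr 1
    ring
  have h2 : Real.exp (-(γ / 2 - Real.log 3) * D) ≤ Real.exp (-(2 * c * L)) := by
    rw [Real.exp_le_exp, neg_mul, neg_le_neg_iff]
    have h5 : 2 * c * √(2 * γ) = γ / 2 - Real.log 3 := by rw [hc]; field_simp
    rw [← h5, mul_assoc (2 * c)]
    exact mul_le_mul_of_nonneg_left hLD (by positivity)
  -- Half of the decay rate `2c` is spent on absorbing the factor `K ≤ L`.
  have h6 : L ≤ c⁻¹ * Real.exp (c * L) := by
    rw [inv_mul_eq_div, le_div_iff₀ hc0]
    linarith [Real.add_one_le_exp (c * L)]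
  have h7 : Real.exp (-(2 * c * L)) = Real.exp (-c * L) * Real.exp (-(c * L)) := by
    rw [← Real.exp_add]
    congr 1
    ring
  rw [h1]
  calc Real.exp (-(γ / 2 - Real.log 3) * D) * K / 4
      ≤ Real.exp (-(2 * c * L)) * (c⁻¹ * Real.exp (c * L)) / 4 := by
        gcongr
        exact hKL.trans h6
    _ = c⁻¹ * Real.exp (-c * L) / 4 := by
        rw [h7, Real.exp_neg (c * L)]
        field_simp
    _ ≤ c⁻¹ * Real.exp (-c * L) := by
        have : 0 ≤ c⁻¹ * Real.exp (-c * L) := by positivity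
        linarith

/-- The exponent `N δ² q` is at least `exp(L² - 2√γ L + log q)`. For large `L` the gain `εL²` over
`(1 - ε)L²` beats the linear terms, so the exponent exceeds `log d + L`. -/
lemma misselection_term_le {γ ε q L D δ N d : ℝ} (hγ : 0 < γ) (hε : 0 < ε) (hε1 : ε < 1)
    (hq : 0 < q) (hL1 : 1 ≤ L) (hL : (2 * √γ + 1 + |Real.log q|) / ε ≤ L) (hDL : √γ * D ≤ L)
    (hδ : δ = Real.exp (-γ * D)) (hN : Real.exp (L ^ 2) ≤ N) (hd : 0 < d)
    (hdL : Real.log d ≤ Real.exp ((1 - ε) * L ^ 2)) :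
    d * Real.exp (-(N * δ ^ 2 * q)) ≤ Real.exp (-L) := by
  rw [← Real.exp_log hd, ← Real.exp_add, Real.exp_le_exp]
  have h1 : Real.exp (-(2 * √γ * L)) ≤ δ ^ 2 := by
    rw [hδ, ← Real.exp_nat_mul, Real.exp_le_exp]
    have : γ * D ≤ √γ * L := by
      conv_lhs => rw [← Real.mul_self_sqrt hγ.le, mul_assoc]
      exact mul_le_mul_of_nonneg_left hDL (Real.sqrt_nonneg γ)
    push_cast
    linarith
  have h2 : L ≤ Real.log q + ε * L ^ 2 - 2 * √γ * L := by
    rw [div_le_iff₀ hε] at hL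
    have h3 : (2 * √γ + 1 + |Real.log q|) * L ≤ L * ε * L :=
      mul_le_mul_of_nonneg_right hL (by linarith)
    have h4 := neg_abs_le (Real.log q)
    nlinarith [abs_nonneg (Real.log q)]
  have h5 : Real.exp ((1 - ε) * L ^ 2) * (L + 1) ≤ N * δ ^ 2 * q := by
    calc Real.exp ((1 - ε) * L ^ 2) * (L + 1)
        ≤ Real.exp ((1 - ε) * L ^ 2) *
            Real.exp (Real.log q + ε * L ^ 2 - 2 * √γ * L) := by
          gcongr
          exact (Real.add_one_le_exp L).trans (Real.exp_le_exp.mpr h2)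
      _ = Real.exp (L ^ 2) * Real.exp (-(2 * √γ * L)) * q := by
          nth_rewrite 2 [← Real.exp_log hq]
          rw [← Real.exp_add, ← Real.exp_add, ← Real.exp_add]
          congr 1
          ring
      _ ≤ N * δ ^ 2 * q := by
          have hN0 : 0 ≤ N := (Real.exp_pos _).le.trans hN
          gcongr
  have h6 : 1 ≤ Real.exp ((1 - ε) * L ^ 2) :=
    Real.one_le_exp (mul_nonneg (by linarith) (sq_nonneg L))
  nlinarith

end HypercubeRegression

end

/-! ### Choice of the constants and conclusion -/

open HypercubeRegression
theorem theorem3 (γ : ℝ) (hγ : 2 * Real.log 3 < γ) :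
    ∃ c₀ : ℝ, 0 < c₀ ∧
      ∀ (σ : ℝ≥0) (ε : ℝ), 0 < ε → ε < 1 →
        ∃ c C C' : ℝ, 0 < c ∧ 0 < C ∧ 0 < C' ∧
          ∀ n d : ℕ, 2 ≤ n → 1 ≤ d → Real.log d ≤ (n : ℝ) ^ (1 - ε) →
          ∀ (Ω : Type*) [MeasurableSpace Ω] (P : Measure Ω) [IsProbabilityMeasure P]
            (X : Fin n → Ω → Cube d) (ξ : Fin n → Ω → ℝ), IsRegressionModel P σ X ξ →
          ∀ K : ℝ, 0 < K → K ≤ d → ∀ f ∈ monotoneClass d K,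
            risk P X ξ (fourierEstimator γ c₀) f ≤
                C * (K / √(Real.log n)) + C' * Real.exp (-c * √(Real.log n)) ∧
            (K ≤ √(Real.log n) →
              risk P X ξ (fourierEstimator γ c₀) f ≤
                C * (totalInfluenceTwo f / √(Real.log n)) +
                  C' * Real.exp (-c * √(Real.log n))) := by
  have h3 : 0 < Real.log 3 := Real.log_pos (by norm_num)
  have hγ0 : 0 < γ := by linarith
  have hs : 0 < √γ := Real.sqrt_pos.mpr hγ0
  have hs2 : 0 < √(2 * γ) := Real.sqrt_pos.mpr (by linarith)
  have hκ : 0 < γ / 2 - Real.log 3 := by linarith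
  obtain ⟨A, hA⟩ : ∃ A, A = 4 * √(2 * γ) + 1 := ⟨_, rfl⟩
  have hlogA : 0 ≤ Real.log A := Real.log_nonneg (by linarith)
  obtain ⟨e, he⟩ : ∃ e, e = (Real.log A + 1) / √γ + 1 := ⟨_, rfl⟩
  have he0 : 0 < e := by rw [he]; positivity
  -- Chosen so that `c₀/2 - √γ = e`, the margin that the variance term requires.
  obtain ⟨c₀, hc₀⟩ : ∃ c₀, c₀ = 2 * (e + √γ) := ⟨_, rfl⟩
  have hc₀0 : 0 < c₀ := by rw [hc₀]; positivity
  refine ⟨c₀, hc₀0, fun σ ε hε hε1 => ?_⟩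
  obtain ⟨c₁, hc₁⟩ : ∃ c₁, c₁ = (γ / 2 - Real.log 3) / √(2 * γ) / 2 := ⟨_, rfl⟩
  have hc₁0 : 0 < c₁ := by rw [hc₁]; positivity
  -- `8192 = 4 · 2048`: the misselection bound is applied with `N = 4⌊n/2⌋ ≥ n`.
  obtain ⟨q, hq⟩ : ∃ q : ℝ, q = 1 / (8192 * (1 + σ) ^ 2) := ⟨_, rfl⟩
  have hq0 : 0 < q := by rw [hq]; positivity
  obtain ⟨V, hV⟩ : ∃ V : ℝ, V = 2 + 8 * Real.exp (σ ^ 2 / 2) := ⟨_, rfl⟩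
  have hV0 : 0 < V := by rw [hV]; positivity
  obtain ⟨L₀, hL₀⟩ : ∃ L₀, L₀ = max (2 * c₀) (max 1 ((2 * √γ + 1 + |Real.log q|) / ε)) := ⟨_, rfl⟩
  obtain ⟨c, hc⟩ : ∃ c, c = min 1 c₁ := ⟨_, rfl⟩
  have hc0 : 0 < c := by rw [hc]; exact lt_min one_pos hc₁0
  refine ⟨c, √(2 * γ) + 1, 2 * V + c₁⁻¹ + 6 + Real.exp (c * L₀), hc0, by positivity, by positivity,
    ?_⟩
  intro n d hn hd hdn Ω _ P _ X ξ hmodel K hK _ f hf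
  obtain ⟨L, hL⟩ : ∃ L, L = √(Real.log n) := ⟨_, rfl⟩
  rw [← hL]
  have hn1 : (1 : ℝ) < n := by exact_mod_cast hn
  have hlogn : 0 < Real.log n := Real.log_pos hn1
  have hL0 : 0 < L := hL ▸ Real.sqrt_pos.mpr hlogn
  have hLn : Real.log n = L ^ 2 := by rw [hL, Real.sq_sqrt hlogn.le]
  have hnL : (n : ℝ) = Real.exp (L ^ 2) := by rw [← hLn, Real.exp_log (by linarith)]
  have hI2 := totalInfluenceTwo_nonneg f
  have hI2K : totalInfluenceTwo f ≤ K :=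
    (totalInfluenceTwo_le_totalInfluenceOne hf.1).trans hf.2.2
  have hone := IsRegressionModel.risk_fourierEstimator_le_one (P := P) (X := X) (ξ := ξ) γ c₀ hf.1
  -- The refined bound gives both claims: for `K ≤ L` use `I⁽²⁾(f) ≤ K`, and for `K ≥ L` the term
  -- `K/L` already exceeds the risk.
  suffices h : K ≤ L → risk P X ξ (fourierEstimator γ c₀) f ≤
      (√(2 * γ) + 1) * (totalInfluenceTwo f / L) +
        (2 * V + c₁⁻¹ + 6 + Real.exp (c * L₀)) * Real.exp (-c * L) by
    refine ⟨?_, h⟩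
    rcases le_total K L with hKL | hKL
    · refine (h hKL).trans ?_
      gcongr
    · refine hone.trans ?_
      have h1 : 1 ≤ K / L := (one_le_div hL0).mpr hKL
      have h2 : 0 ≤ (2 * V + c₁⁻¹ + 6 + Real.exp (c * L₀)) * Real.exp (-c * L) := by positivity
      nlinarith
  intro hKL
  -- Below `L₀` the summand `exp(c L₀)` of the constant makes the right-hand side at least `1`.
  rcases lt_or_ge L L₀ with hLL | hLL
  · refine hone.trans ?_
    have h1 : 1 ≤ Real.exp (c * L₀) * Real.exp (-c * L) := by
      rw [← Real.exp_add]
      have := mul_le_mul_of_nonneg_left hLL.le hc0.le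
      exact Real.one_le_exp (by linarith)
    have h2 : 0 ≤ (√(2 * γ) + 1) * (totalInfluenceTwo f / L) := by positivity
    have h4 : 0 ≤ (2 * V + c₁⁻¹ + 6) * Real.exp (-c * L) := by positivity
    linarith
  rw [hL₀, max_le_iff, max_le_iff] at hLL
  obtain ⟨hLc, hL1, hLq⟩ := hLL
  obtain ⟨hLD, hDL⟩ := degreeCutoff_bounds hγ0 hc₀0 hLc hLn
  obtain ⟨k, hk⟩ : ∃ k, degreeCutoff γ c₀ n = k := ⟨_, rfl⟩
  obtain ⟨δ, hδ⟩ : ∃ δ, influenceCutoff γ c₀ n = δ := ⟨_, rfl⟩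
  have hk0 : 0 < (k : ℝ) := by exact_mod_cast hk ▸ degreeCutoff_pos γ c₀ n
  have hδk : δ = Real.exp (-γ * k) := by rw [← hδ, ← hk]; rfl
  rw [hk] at hLD hDL
  have hce : c₀ / 2 - √γ = e := by rw [hc₀]; ring
  rw [hce] at hDL
  have heL : e ≤ L := by linarith
  refine (hmodel.risk_fourierEstimator_le hn hγ0 c₀ hK hf hk hδ).trans ?_
  have hexpL : Real.exp (-L) ≤ Real.exp (-c * L) := by
    rw [Real.exp_le_exp]
    have := mul_le_mul_of_nonneg_right (hc.trans_le (min_le_left 1 c₁)) hL0.le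
    linarith
  have hexpc : Real.exp (-c₁ * L) ≤ Real.exp (-c * L) := by
    rw [Real.exp_le_exp]
    have := mul_le_mul_of_nonneg_right (hc.trans_le (min_le_right 1 c₁)) hL0.le
    linarith
  have t1 : ((4 * K / k + 1) / δ * Real.exp 1) ^ k *
      ((2 + 8 * Real.exp (σ ^ 2 / 2)) / ((n - n / 2 : ℕ) : ℝ)) ≤ 2 * V * Real.exp (-L) := by
    have h1 := variance_term_le hγ0 hA he heL rfl hk0 hLD hDL hδk hK hKL
    have h2 : Real.exp (L ^ 2) / 2 ≤ ((n - n / 2 : ℕ) : ℝ) := by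
      rw [← hnL, div_le_iff₀ two_pos]
      exact_mod_cast (by omega : n ≤ (n - n / 2) * 2)
    rw [← hV]
    calc _ ≤ Real.exp (L ^ 2 - L) * (V / (Real.exp (L ^ 2) / 2)) := by gcongr
      _ = 2 * V * Real.exp (-L) := by
          rw [sub_eq_add_neg, Real.exp_add]
          field_simp
  have t2 : totalInfluenceTwo f / (4 * k) ≤ (√(2 * γ) + 1) * (totalInfluenceTwo f / L) := by
    rw [← mul_div_assoc, div_le_div_iff₀ (by positivity) hL0]
    have h1 := mul_le_mul_of_nonneg_left hLD hI2
    have h2 : 0 ≤ totalInfluenceTwo f * k := by positivity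
    have h4 : 0 ≤ totalInfluenceTwo f * k * √(2 * γ) := by positivity
    linarith
  have t3 := low_influence_term_le hγ rfl hLD hδk hK hKL hc₁
  have t4 : 6 * d * Real.exp (-((n / 2 : ℕ) * δ ^ 2 / (2048 * (1 + σ) ^ 2))) ≤
      6 * Real.exp (-L) := by
    have h1 : (n : ℝ) ≤ 4 * (n / 2 : ℕ) := by exact_mod_cast (by omega : n ≤ 4 * (n / 2))
    have h2 : (n / 2 : ℕ) * δ ^ 2 / (2048 * (1 + σ) ^ 2) = 4 * (n / 2 : ℕ) * δ ^ 2 * q := by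
      rw [hq]
      field_simp
      ring
    rw [h2, mul_assoc]
    refine mul_le_mul_of_nonneg_left ?_ (by norm_num)
    refine misselection_term_le hγ0 hε hε1 hq0 hL1 hLq (hDL.trans (by linarith)) hδk
      (hnL ▸ h1) (by exact_mod_cast hd) (hdn.trans_eq ?_)
    rw [Real.rpow_def_of_pos (by linarith), hLn, mul_comm]
  have h5 : c₁⁻¹ * Real.exp (-c₁ * L) ≤ c₁⁻¹ * Real.exp (-c * L) := by gcongr
  have h6 : 2 * V * Real.exp (-L) ≤ 2 * V * Real.exp (-c * L) := by gcongr
  have h7 : 0 ≤ Real.exp (c * L₀) * Real.exp (-c * L) := by positivity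
  linarith
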